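/- Let $K$ be a field. All graded vector spaces are $\mathbb Z$-graded $K$-vector spaces, $A=\bigoplus_{n\in\mathbb Z}A_n$, tensor products of graded maps are evaluated with the Koszul sign $(f\otimes g)(x\otimes y)=(-1)^{|g||x|}f(x)\otimes g(y)$, and differentials have degree $-1$. An $HA_\infty$-algebra $(A,\mu_k,\alpha)$ is a graded vector space $A$ with linear maps $\mu_k:A^{\otimes k}\to A$ of degree $k-2$ for all $k\ge 1$ and a linear map $\alpha:A\to A$ of degree $0$ such that $\alpha\circ\mu_k=\mu_k\circ\alpha^{\otimes k}$ for all $k\ge 1$ and, for all $n\ge1$ and all homogeneous $a_1,\dots,a_n\in A$, $$\sum_{i+j=n+1,\ i,j\ge 1}\ \sum_{\lambda=1}^{j}(-1)^{\lambda(i+1)+i(|a_1|+\cdots+|a_{\lambda-1}|)}\,\mu_j\big(\alpha^{i-1}a_1,\dots,\alpha^{i-1}a_{\lambda-1},\mu_i(a_\lambda,\dots,a_{\lambda+i-1}),\alpha^{i-1}a_{\lambda+i},\dots,\alpha^{i-1}a_n\big)=0 .$$ Let $(A,d_A)$ and $(H,d_H)$ be chain complexes, and let $p:A\to H$, $i:H\to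 A$ be chain maps and $h:A\to A$ a linear map of degree $+1$ with $$1_A-i\circ p=d_Ah+hd_A,\qquad p\circ i=1_H .$$ Let $(A,\mu_k,\alpha)$ be an $HA_\infty$-algebra with $\mu_1=d_A$ and $\alpha\circ h=h\circ\alpha$. Put $\varphi_1=\mathrm{id}_A$ and, recursively for $k\ge 2$, $$\mu_k^A=\sum_{\substack{i_1+\cdots+i_l=k\\ i_1,\dots,i_l\ge1,\ 2\le l\le k}}(-1)^{\theta(i_1,\dots,i_l)}\,\mu_l\Big(\alpha^{\sum_{q\ne1}(i_q-1)}\circ\varphi_{i_1}\otimes\cdots\otimes\alpha^{\sum_{q\ne l}(i_q-1)}\circ\varphi_{i_l}\Big),\qquad \varphi_k=-h\circ\mu_k^A,$$ where $\theta(i_1,\dots,i_l)=\sum_{1\le s<t\le l}i_s(i_t+1)$ (equivalently, $\mu_k^A$ is a sum over planar trees with $k$ leaves). Define on $H$ $$\mu_1^H=d_H,\qquad \mu_k^H=p\circ\mu_k^A\circ i^{\otimes k}\ \ (k\ge2),\qquad \alpha_H=p\circ\alpha\circ i .$$ Theorem. $(H,\mu_k^H,\alpha_H)$ is an $HA_\infty$-algebra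 whose underlying chain complex $(H,\mu_1^H)$ is $(H,d_H)$. -/

import Mathlib

/-!
Graded vector spaces are internally graded: a `K`-vector space `A` with subspaces `𝒜 n`, `n : ℤ`,
such that `A = ⨁ n, 𝒜 n` (`DirectSum.Decomposition 𝒜`). A linear map `A^{⊗ k} → A` is a `K`-multilinear
map in `k` variables. A family `μ` of such maps is indexed by all `k : ℕ`, but only the members
with `k ≥ 1` are ever used or constrained.
-/

namespace HomAInfinity

variable {K : Type*} [Field K]
variable {A : Type*} [AddCommGroup A] [Module K A]
variable {H : Type*} [AddCommGroup H] [Module K H]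

/-- `f : A → H` is a graded linear map of degree `e`. -/
def IsLinOfDegree (𝒜 : ℤ → Submodule K A) (ℋ : ℤ → Submodule K H) (f : A →ₗ[K] H) (e : ℤ) : Prop :=
  ∀ (n : ℤ), ∀ a ∈ 𝒜 n, f a ∈ ℋ (n + e)

/-- `f : A^{⊗ k} → A` is a graded multilinear map of degree `e`. -/
def IsMultiOfDegree (𝒜 : ℤ → Submodule K A) {k : ℕ}
    (f : MultilinearMap K (fun _ : Fin k => A) A) (e : ℤ) : Prop :=
  ∀ (d : Fin k → ℤ) (a : Fin k → A), (∀ j, a j ∈ 𝒜 (d j)) → f a ∈ 𝒜 ((∑ j, d j) + e)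

/-- The arguments `(α^{i-1} a₁, …, α^{i-1} a_{λ-1}, μ_i(a_λ, …, a_{λ+i-1}), α^{i-1} a_{λ+i}, …)` of the
outer operation in the structure identities, with `r = λ - 1` elements in front. The sequence
`a 0, a 1, …` stands for `a₁, a₂, …`. -/
def insertArgs (μ : ∀ k : ℕ, MultilinearMap K (fun _ : Fin k => A) A) (α : A →ₗ[K] A)
    (i r : ℕ) (a : ℕ → A) (q : ℕ) : A :=
  if q < r then (α ^ (i - 1)) (a q)
  else if q = r then μ i (fun m => a (r + (m : ℕ)))
  else (α ^ (i - 1)) (a (q + i - 1))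

/-- `(A, μ_k, α)` is an `HA_∞`-algebra. The identities are the usual ones
`∑_{i+j=n+1} ∑_{λ=1}^{j} ± μ_j(α^{i-1} a₁, …, μ_i(a_λ, …), …, α^{i-1} a_n) = 0` for homogeneous
`a₁, …, a_n` (`n ≥ 1`), with the sign `(-1)^{λ(i+1) + i(|a₁|+⋯+|a_{λ-1}|)}`.
The elements are given as a sequence `a 0, a 1, …`, of which only the first `n` entries occur. -/
structure IsHAInfinity (𝒜 : ℤ → Submodule K A)
    (μ : ∀ k : ℕ, MultilinearMap K (fun _ : Fin k => A) A) (α : A →ₗ[K] A) : Prop where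
  degree_μ : ∀ k : ℕ, 1 ≤ k → IsMultiOfDegree 𝒜 (μ k) ((k : ℤ) - 2)
  degree_α : IsLinOfDegree 𝒜 𝒜 α 0
  α_μ : ∀ k : ℕ, 1 ≤ k → ∀ a : Fin k → A, α (μ k a) = μ k (fun j => α (a j))
  identity : ∀ n : ℕ, 1 ≤ n → ∀ (d : ℕ → ℤ) (a : ℕ → A), (∀ m, a m ∈ 𝒜 (d m)) →
    ∑ i ∈ Finset.Icc 1 n, ∑ l ∈ Finset.Icc 1 (n + 1 - i),
      Int.negOnePow ((l : ℤ) * (i + 1) + i * ∑ m ∈ Finset.range (l - 1), d m) •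
        μ (n + 1 - i) (fun q => insertArgs μ α i (l - 1) a q) = 0

/-- `(A, d)` is a chain complex: `d` has degree `-1` and square zero. -/
structure IsChainComplex (𝒜 : ℤ → Submodule K A) (d : A →ₗ[K] A) : Prop where
  degree : IsLinOfDegree 𝒜 𝒜 d (-1)
  sq_zero : ∀ a, d (d a) = 0

/-- `(p, i, h)` is a contraction from `(A, dA)` to `(H, dH)`: chain maps `p : A → H`, `i : H → A`
and a map `h` of degree `+1` with `1 - i p = dA h + h dA` and `p i = 1`. -/
structure IsContraction (𝒜 : ℤ → Submodule K A) (ℋ : ℤ → Submodule K H)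
    (dA : A →ₗ[K] A) (dH : H →ₗ[K] H) (p : A →ₗ[K] H) (i : H →ₗ[K] A) (h : A →ₗ[K] A) : Prop where
  degree_p : IsLinOfDegree 𝒜 ℋ p 0
  degree_i : IsLinOfDegree ℋ 𝒜 i 0
  degree_h : IsLinOfDegree 𝒜 𝒜 h 1
  chain_p : ∀ a, p (dA a) = dH (p a)
  chain_i : ∀ x, i (dH x) = dA (i x)
  homotopy : ∀ a, a - i (p a) = dA (h a) + h (dA a)
  retract : ∀ x, p (i x) = x

section Transfer

variable (𝒜 : ℤ → Submodule K A) [DirectSum.Decomposition 𝒜]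

/-- The linear map `a ↦ (-1)^{|a|} a`. Koszul signs of tensor products of graded maps are
expressed through it: `(f ⊗ g)(x ⊗ y) = (-1)^{|g| |x|} f x ⊗ g y`. -/
noncomputable def koszul : A →ₗ[K] A :=
  (DirectSum.toModule K ℤ A fun n => Int.negOnePow n • (𝒜 n).subtype) ∘ₗ
    (DirectSum.decomposeLinearEquiv 𝒜).toLinearMap

theorem koszul_of_mem {n : ℤ} {a : A} (ha : a ∈ 𝒜 n) : koszul 𝒜 a = Int.negOnePow n • a := by
  have h1 : DirectSum.decompose 𝒜 a = DirectSum.of (fun n => 𝒜 n) n ⟨a, ha⟩ :=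
    DirectSum.decompose_of_mem 𝒜 ha
  have h2 : koszul 𝒜 a = DirectSum.toModule K ℤ A (fun n => Int.negOnePow n • (𝒜 n).subtype)
      (DirectSum.decompose 𝒜 a) := rfl
  rw [h2, h1, ← DirectSum.lof_eq_of K, DirectSum.toModule_lof]
  rfl

/-- Plug `φ 1, φ 2, …` into the consecutive blocks of a composition `c = (i₁, …, i_l)` of `k`, and
the results into `f`: this is `f (φ_{i₁} ⊗ ⋯ ⊗ φ_{i_l})`, without Koszul signs. -/
noncomputable def plug {k : ℕ} (c : Composition k) (f : MultilinearMap K (fun _ : Fin c.length => A) A)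
    (φ : ∀ s : Fin c.length, MultilinearMap K (fun _ : Fin (c.blocksFun s) => A) A) :
    MultilinearMap K (fun _ : Fin k => A) A :=
  (f.compMultilinearMap φ).domDomCongr c.blocksFinEquiv

theorem plug_apply {k : ℕ} (c : Composition k) (f : MultilinearMap K (fun _ : Fin c.length => A) A)
    (φ : ∀ s : Fin c.length, MultilinearMap K (fun _ : Fin (c.blocksFun s) => A) A)
    (a : Fin k → A) : plug c f φ a = f (fun s => φ s (a ∘ c.embedding s)) := rfl

/-- `θ(i₁, …, i_l) = ∑_{s < t} i_s (i_t + 1)`. -/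
def theta {k : ℕ} (c : Composition k) : ℕ :=
  ∑ s : Fin c.length, ∑ t ∈ Finset.Ioi s, c.blocksFun s * (c.blocksFun t + 1)

/-- `∑ (-1)^{θ(i₁, …, i_l)} μ_l (α^{∑_{t ≠ 1} (i_t - 1)} φ_{i₁} ⊗ ⋯ ⊗ α^{∑_{t ≠ l} (i_t - 1)} φ_{i_l})`
over all `i₁ + ⋯ + i_l = k` with `i₁, …, i_l ≥ 1` and `l ≥ 2`, where `φ_m` has degree `m - 1`.
The Koszul sign of the tensor product is produced by applying `a ↦ (-1)^{|a|} a` to each input of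
the `s`-th block `∑_{t > s} (i_t - 1)` times, once for each unit of degree of the maps moved past it. -/
noncomputable def nodeSum (μ : ∀ k : ℕ, MultilinearMap K (fun _ : Fin k => A) A) (α : A →ₗ[K] A)
    (φ : ∀ m : ℕ, MultilinearMap K (fun _ : Fin m => A) A) (k : ℕ) :
    MultilinearMap K (fun _ : Fin k => A) A :=
  ∑ c : Composition k with 2 ≤ c.length,
    Int.negOnePow (theta c) • plug c (μ c.length) (fun s =>
      (α ^ ∑ t ∈ Finset.univ.erase s, (c.blocksFun t - 1)).compMultilinearMap
        ((φ (c.blocksFun s)).compLinearMap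
          (fun _ => koszul 𝒜 ^ ∑ t ∈ Finset.Ioi s, (c.blocksFun t - 1))))

/-- The maps `φ_1 = id` and `φ_k = -h ∘ μ_k^A` for `k ≥ 2`, see `branch_one` and
`branch_of_two_le`. -/
noncomputable def branch (μ : ∀ k : ℕ, MultilinearMap K (fun _ : Fin k => A) A) (α h : A →ₗ[K] A) :
    ∀ k : ℕ, MultilinearMap K (fun _ : Fin k => A) A
  | 0 => 0
  | 1 => MultilinearMap.ofSubsingleton K A A 0 LinearMap.id
  | k + 2 => (-h).compMultilinearMap
      (nodeSum 𝒜 μ α (fun m => if _hm : m < k + 2 then branch μ α h m else 0) (k + 2))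

/-- The operations `μ_k^A`, `k ≥ 2`: the sum over planar trees with `k` leaves. -/
noncomputable def treeOp (μ : ∀ k : ℕ, MultilinearMap K (fun _ : Fin k => A) A) (α h : A →ₗ[K] A)
    (k : ℕ) : MultilinearMap K (fun _ : Fin k => A) A :=
  nodeSum 𝒜 μ α (branch 𝒜 μ α h) k

theorem branch_one (μ : ∀ k : ℕ, MultilinearMap K (fun _ : Fin k => A) A) (α h : A →ₗ[K] A)
    (a : Fin 1 → A) : branch 𝒜 μ α h 1 a = a 0 := by
  rw [branch]; rfl

theorem blocksFun_lt_of_two_le_length {k : ℕ} (c : Composition k) (hc : 2 ≤ c.length)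
    (s : Fin c.length) : c.blocksFun s < k := by
  have hk : 0 < k := by have := c.length_le; omega
  refine (c.ne_single_iff hk).1 (fun h => ?_) s
  rw [h, Composition.single_length] at hc
  omega

theorem branch_of_two_le (μ : ∀ k : ℕ, MultilinearMap K (fun _ : Fin k => A) A)
    (α h : A →ₗ[K] A) {k : ℕ} (hk : 2 ≤ k) :
    branch 𝒜 μ α h k = (-h).compMultilinearMap (treeOp 𝒜 μ α h k) := by
  obtain ⟨k, rfl⟩ := Nat.exists_eq_add_of_le' hk
  rw [branch, treeOp, nodeSum, nodeSum]
  congr 1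
  refine Finset.sum_congr rfl fun c hc => ?_
  have hc' : 2 ≤ c.length := by simpa using hc
  congr 2
  funext s
  rw [dif_pos (blocksFun_lt_of_two_le_length c hc' s)]

/-- The transferred operations on `H`: `μ_1^H = d_H` and `μ_k^H = p ∘ μ_k^A ∘ i^{⊗ k}`, `k ≥ 2`. -/
noncomputable def transferredOp (μ : ∀ k : ℕ, MultilinearMap K (fun _ : Fin k => A) A)
    (α : A →ₗ[K] A) (dH : H →ₗ[K] H) (p : A →ₗ[K] H) (i : H →ₗ[K] A) (h : A →ₗ[K] A) :
    ∀ k : ℕ, MultilinearMap K (fun _ : Fin k => H) H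
  | 0 => 0
  | 1 => MultilinearMap.ofSubsingleton K H H 0 dH
  | k + 2 => p.compMultilinearMap ((treeOp 𝒜 μ α h (k + 2)).compLinearMap fun _ => i)

end Transfer

end HomAInfinity

/-! The proof is the bar construction argument for homotopy transfer. If `α` were invertible, the
operations `α^{-(k-1)} μ_k` would form an ordinary `A_∞`-algebra. As `α` need not be invertible,
negative powers are kept formally: a letter carries a weight and a degree, and a word is brought to
a common weight before an operation is applied. After suspension the operations become one function
`b` of degree `-1` on words, with coderivation `D`, and the structure identities say `b ∘ D = 0` on
homogeneous words (`wordDer_wordOp`).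

Write `b_A`, `D_A` and `b_H`, `D_H` for the two sides, `T` for the tree operations composed with
`i`, and `ψ` for the `φ_k` composed with `i`. Let `F` be the coalgebra morphism with components `ψ`.
Separating the one-block term gives `b_A F = T + d_A ψ` (`wordLift_comorphism`). On words, `ψ = i -
h T` and `b_H = d_H + p T`, where `i` and `d_H` act on single letters only. The homotopy formula
then gives `b_A F - ψ D_H = h (d_A T + T D_H)` (`branchWordOp_defect`).

The central claim is `d_A T + T D_H = 0`, by strong induction on word length
(`treeWordOp_identity`). On shorter words it gives `b_A F = ψ D_H`. Since `b_A D_A F = 0`, the value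
`b_A F D_H` equals `b_A (F D_H - D_A F)`, in which only the full word contributes, so it is `d_A (ψ
D_H - b_A F)` (`wordDer_wordLift_comorphism`). Substituting `b_A F = T + d_A ψ` and `d_A² = 0`
leaves `T D_H = -d_A T`. Applying `p` yields `b_H D_H = 0`, which is the family of identities on
`H`.

Compatibility with `α_H` holds because `α` commutes with `d_A` and `h`, hence with `i p = 1 - d_A h
- h d_A`. No side conditions such as `h² = 0` enter. -/

namespace HomAInfinity

/-! ### Deconcatenation of words, convolution, and coderivations -/

section Words

variable {X M N R : Type*}

/-- The sum of `F u v` over all ways to write a word as `u ++ v`. -/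
def splitSum [AddCommMonoid M] : (List X → List X → M) → List X → M
  | F, [] => F [] []
  | F, x :: w => F [] (x :: w) + splitSum (fun u v => F (x :: u) v) w

section AddCommMonoid

variable [AddCommMonoid M] [AddCommMonoid N]

theorem splitSum_congr (w : List X) {F G : List X → List X → M}
    (hFG : ∀ u v, u ++ v = w → F u v = G u v) : splitSum F w = splitSum G w := by
  induction w generalizing F G with
  | nil => exact hFG [] [] rfl
  | cons x w ih =>
    rw [splitSum, splitSum, hFG [] _ rfl, ih fun u v huv => hFG (x :: u) v (by simp [huv])]

theorem splitSum_add (F G : List X → List X → M) (w : List X) :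
    splitSum (fun u v => F u v + G u v) w = splitSum F w + splitSum G w := by
  induction w generalizing F G with
  | nil => rfl
  | cons x w ih => simp only [splitSum, ih]; abel

theorem splitSum_zero (w : List X) : splitSum (fun _ _ => (0 : M)) w = 0 := by
  induction w with
  | nil => rfl
  | cons x w ih => simp only [splitSum, ih, add_zero]

theorem map_splitSum (g : M →+ N) (F : List X → List X → M) (w : List X) :
    g (splitSum F w) = splitSum (fun u v => g (F u v)) w := by
  induction w generalizing F with
  | nil => rfl
  | cons x w ih => simp only [splitSum, map_add, ih]

/-- Coassociativity of deconcatenation: both sides run over all factorisations `w = a ++ b ++ v`. -/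
theorem splitSum_assoc (F : List X → List X → List X → M) (w : List X) :
    splitSum (fun y v => splitSum (fun a b => F a b v) y) w =
      splitSum (fun a y => splitSum (fun b v => F a b v) y) w := by
  induction w generalizing F with
  | nil => rfl
  | cons x w ih =>
    simp only [splitSum, splitSum_add]
    rw [ih fun a b v => F (x :: a) b v, add_assoc]

theorem splitSum_comm {Y : Type*} (F : List X → List X → List Y → List Y → M) (w : List X)
    (w' : List Y) : splitSum (fun u v => splitSum (fun u' v' => F u v u' v') w') w =
      splitSum (fun u' v' => splitSum (fun u v => F u v u' v') w) w' := by
  induction w generalizing F with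
  | nil => rfl
  | cons x w ih => simp only [splitSum, splitSum_add, ih]

theorem splitSum_append_cons (F : List X → List X → M) (u : List X) (x : X) (v : List X) :
    splitSum F (u ++ x :: v) = splitSum (fun a b => F a (b ++ x :: v)) u +
      splitSum (fun a b => F (u ++ x :: a) b) v := by
  induction u generalizing F with
  | nil => rfl
  | cons y u ih => simp only [List.cons_append, splitSum, ih, add_assoc]

theorem splitSum_eq_sum (F : List X → List X → M) (w : List X) :
    splitSum F w = ∑ n ∈ Finset.range (w.length + 1), F (w.take n) (w.drop n) := by
  induction w generalizing F with
  | nil => simp [splitSum]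
  | cons x w ih =>
    rw [splitSum, ih, List.length_cons, Finset.sum_range_succ' _ (w.length + 1), add_comm]
    rfl

end AddCommMonoid

theorem splitSum_smul [AddCommGroup M] (c : ℤˣ) (F : List X → List X → M) (w : List X) :
    splitSum (fun u v => c • F u v) w = c • splitSum F w :=
  (map_splitSum (DistribSMul.toAddMonoidHom M c) F w).symm

section Ring

variable [Ring R]

/-- The convolution product of functions on words, dual to deconcatenation. -/
def conv (f g : List X → R) (w : List X) : R := splitSum (fun u v => f u * g v) w

theorem splitSum_mul (F : List X → List X → R) (w : List X) (r : R) :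
    splitSum F w * r = splitSum (fun u v => F u v * r) w :=
  map_splitSum (AddMonoidHom.mulRight r) F w

theorem mul_splitSum (F : List X → List X → R) (w : List X) (r : R) :
    r * splitSum F w = splitSum (fun u v => r * F u v) w :=
  map_splitSum (AddMonoidHom.mulLeft r) F w

theorem conv_assoc (f g k : List X → R) : conv (conv f g) k = conv f (conv g k) := by
  funext w
  simp only [conv, splitSum_mul, mul_splitSum, ← mul_assoc]
  exact splitSum_assoc (fun a b v => f a * g b * k v) w

theorem conv_add (f g k : List X → R) : conv f (g + k) = conv f g + conv f k := by
  funext w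
  simp only [conv, Pi.add_apply, mul_add, splitSum_add]

theorem add_conv (f g k : List X → R) : conv (f + g) k = conv f k + conv g k := by
  funext w
  simp only [conv, Pi.add_apply, add_mul, splitSum_add]

/-- The unit of the convolution product. -/
def convOne (w : List X) : R := if w = [] then 1 else 0

theorem convOne_conv (f : List X → R) : conv convOne f = f := by
  funext w
  cases w with
  | nil => simp [conv, splitSum, convOne]
  | cons x w => simp [conv, splitSum, convOne, splitSum_zero]

/-- The twist of a function on words by a sign. -/
def signed (sg : List X → ℤˣ) (f : List X → R) (w : List X) : R := sg w • f w

theorem signed_conv {sg : List X → ℤˣ} (hsg : ∀ u v, sg (u ++ v) = sg u * sg v)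
    (f g : List X → R) : signed sg (conv f g) = conv (signed sg f) (signed sg g) := by
  funext w
  simp only [signed, conv]
  rw [← splitSum_smul]
  refine splitSum_congr w fun u v huv => ?_
  rw [← huv, hsg, smul_mul_smul_comm]

end Ring

section Derivation

/-- The pull-back of a function `f` on words along the coderivation determined by `b`:
`w ↦ ∑ ± f (u ++ b m :: v)`, over all ways to write `w` as `u ++ m ++ v` with `m` nonempty. -/
def wordDer [AddCommGroup M] (b : List X → X) (sg : List X → ℤˣ) (f : List X → M) (w : List X) :
    M :=
  splitSum (fun u y => splitSum (fun m v => if m = [] then 0 else sg u • f (u ++ b m :: v)) y) w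

variable (b : List X → X) (sg : List X → ℤˣ)

theorem map_wordDer [AddCommGroup M] [AddCommGroup N] (g : M →+ N) (f : List X → M)
    (w : List X) : g (wordDer b sg f w) = wordDer b sg (fun l => g (f l)) w := by
  simp only [wordDer, map_splitSum, apply_ite g, map_zero, Units.smul_def, map_zsmul]

theorem wordDer_add [AddCommGroup M] (f g : List X → M) :
    wordDer b sg (f + g) = wordDer b sg f + wordDer b sg g := by
  funext w
  simp only [wordDer, Pi.add_apply, ← splitSum_add]
  congr! 5 with u y m v
  split_ifs <;> simp

theorem wordDer_convOne [Ring R] : wordDer b sg (convOne : List X → R) = 0 := by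
  funext w
  simp [wordDer, convOne, splitSum_zero]

variable {sg}

/-- The graded Leibniz rule. A cut of the word `u ++ b m :: v` falls either before or after the new
letter `b m`; in the first case the sign of `u` splits multiplicatively, and its first factor twists
`f`. -/
theorem wordDer_conv [Ring R] (hsg : ∀ u v, sg (u ++ v) = sg u * sg v) (f g : List X → R) :
    wordDer b sg (conv f g) = conv (wordDer b sg f) g + conv (signed sg f) (wordDer b sg g) := by
  funext w
  have key : wordDer b sg (conv f g) w =
      splitSum (fun u y => splitSum (fun m v => splitSum (fun a c =>
        if m = [] then 0 else (sg a • f a) * (sg c • g (c ++ b m :: v))) u) y) w +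
      splitSum (fun u y => splitSum (fun m v => splitSum (fun a c =>
        if m = [] then 0 else (sg u • f (u ++ b m :: a)) * g c) v) y) w := by
    rw [wordDer, ← splitSum_add]
    refine splitSum_congr w fun u y _ => ?_
    rw [← splitSum_add]
    refine splitSum_congr y fun m v _ => ?_
    split_ifs with hm
    · simp only [splitSum_zero, add_zero]
    · rw [conv, splitSum_append_cons, smul_add, ← splitSum_smul, ← splitSum_smul]
      congr 1
      · refine splitSum_congr u fun a c hac => ?_
        rw [← hac, hsg, smul_mul_smul_comm]
      · simp only [smul_mul_assoc]
  rw [key, add_comm, Pi.add_apply]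
  congr 1
  · simp only [conv, wordDer, splitSum_mul, ite_mul, zero_mul]
    rw [splitSum_assoc (fun u y v => splitSum (fun m v' =>
      if m = [] then 0 else (sg u • f (u ++ b m :: v')) * g v) y)]
    refine splitSum_congr w fun u y _ => ?_
    exact (splitSum_assoc (fun m a c =>
      if m = [] then 0 else (sg u • f (u ++ b m :: a)) * g c) y).symm
  · simp only [conv, wordDer, mul_splitSum, mul_ite, mul_zero, signed]
    rw [← splitSum_assoc (fun a c y => splitSum (fun m v =>
      if m = [] then 0 else (sg a • f a) * (sg c • g (c ++ b m :: v))) y)]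
    exact splitSum_congr w fun u y _ => splitSum_comm _ y u

end Derivation

end Words

/-! ### Compositions, formal sums of words, and coalgebra morphisms -/

section Composition

variable {M : Type*} [AddCommMonoid M]

/-- A composition of `n + 1` is a first block `m + 1` together with a composition of `n - m`. -/
theorem sum_composition_succ (n : ℕ) (G : List ℕ → M) :
    ∑ c : Composition (n + 1), G c.blocks =
      ∑ m ∈ Finset.range (n + 1), ∑ c : Composition (n - m), G ((m + 1) :: c.blocks) := by
  rw [Finset.sum_sigma' (Finset.range (n + 1)) (fun m => (Finset.univ : Finset (Composition (n - m))))
    (fun m c => G ((m + 1) :: c.blocks))]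
  symm
  refine Finset.sum_bij (fun x hx => ⟨(x.1 + 1) :: x.2.blocks, ?_, ?_⟩) ?_ ?_ ?_ ?_
  · intro i hi
    rcases List.mem_cons.1 hi with rfl | hi
    · exact Nat.succ_pos _
    · exact x.2.blocks_pos hi
  · have h1 := Finset.mem_range.1 (Finset.mem_sigma.1 hx).1
    rw [List.sum_cons, x.2.blocks_sum]
    omega
  · intro x hx
    exact Finset.mem_univ _
  · rintro ⟨m, c⟩ _ ⟨m', c'⟩ _ hcc
    have h1 : (m + 1) :: c.blocks = (m' + 1) :: c'.blocks := congrArg Composition.blocks hcc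
    obtain ⟨h2, h3⟩ := List.cons.inj h1
    obtain rfl : m = m' := by omega
    rw [Composition.ext h3]
  · rintro ⟨bs, hpos, hsum⟩ _
    cases bs with
    | nil => simp at hsum
    | cons k bs =>
      have hk : 0 < k := hpos (by simp)
      rw [List.sum_cons] at hsum
      refine ⟨⟨k - 1, ⟨bs, fun hi => hpos (List.mem_cons_of_mem _ hi), by omega⟩⟩, ?_, ?_⟩
      · simp only [Finset.mem_sigma, Finset.mem_range, Finset.mem_univ, and_true]
        omega
      · simp only [Composition.mk.injEq, List.cons.injEq, and_true]
        omega
  · intro x hx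
    rfl

end Composition

section FreeWords

variable {X L M R : Type*}

/-- The ring of formal sums of words. -/
abbrev FreeWords (L : Type*) := FreeAbelianGroup (FreeMonoid L)

/-- A word, as a formal sum of words. -/
def word (l : List L) : FreeWords L := FreeAbelianGroup.of (FreeMonoid.ofList l)

theorem word_append (l l' : List L) : word (l ++ l') = word l * word l' :=
  FreeAbelianGroup.of_mul (FreeMonoid.ofList l) (FreeMonoid.ofList l')

theorem word_nil : word ([] : List L) = 1 := rfl

/-- The additive extension of a function on words to formal sums of words. -/
def wordLift [AddCommGroup M] (f : List L → M) : FreeWords L →+ M :=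
  FreeAbelianGroup.lift fun l => f (FreeMonoid.toList l)

theorem wordLift_word [AddCommGroup M] (f : List L → M) (l : List L) :
    wordLift f (word l) = f l :=
  FreeAbelianGroup.lift_apply_of _ _

theorem freeWords_hom_ext [AddCommGroup M] {f g : FreeWords L →+ M}
    (hfg : ∀ l, f (word l) = g (word l)) : f = g :=
  FreeAbelianGroup.lift_ext _ _ fun l => hfg (FreeMonoid.toList l)

theorem wordLift_word_mul [AddCommGroup M] (f : List L → M) (l : List L) (z : FreeWords L) :
    wordLift f (word l * z) = wordLift (fun l' => f (l ++ l')) z := by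
  have : (wordLift f).comp (AddMonoidHom.mulLeft (word l)) = wordLift (fun l' => f (l ++ l')) := by
    refine freeWords_hom_ext fun l' => ?_
    simp [← word_append, wordLift_word]
  exact DFunLike.congr_fun this z

theorem wordLift_add [AddCommGroup M] (f g : List L → M) (z : FreeWords L) :
    wordLift (fun l => f l + g l) z = wordLift f z + wordLift g z := by
  have : wordLift (fun l => f l + g l) = wordLift f + wordLift g :=
    freeWords_hom_ext fun l' => by simp [wordLift_word]
  exact DFunLike.congr_fun this z

theorem wordLift_comp [AddCommGroup M] {N : Type*} [AddCommGroup N] (g : M →+ N) (f : List L → M)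
    (z : FreeWords L) : wordLift (fun l => g (f l)) z = g (wordLift f z) := by
  have : wordLift (fun l => g (f l)) = g.comp (wordLift f) :=
    freeWords_hom_ext fun l' => by simp [wordLift_word]
  exact DFunLike.congr_fun this z

variable (Ψ : List X → L)

/-- Cut a word into blocks of the given lengths and apply `Ψ` to the blocks. -/
def blockWord : List ℕ → List X → List L
  | [], _ => []
  | k :: bs, w => Ψ (w.take k) :: blockWord bs (w.drop k)

theorem length_blockWord (bs : List ℕ) (w : List X) : (blockWord Ψ bs w).length = bs.length := by
  induction bs generalizing w with
  | nil => rfl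
  | cons k bs ih => simp [blockWord, ih]

/-- The morphism of coalgebras determined by `Ψ`: the sum of the words `Ψ w₁, …, Ψ w_l` over all ways
to write `w` as `w₁ ++ ⋯ ++ w_l` with nonempty `w₁, …, w_l`. -/
def comorphism (w : List X) : FreeWords L :=
  ∑ c : Composition w.length, word (blockWord Ψ c.blocks w)

/-- The one-letter word `Ψ w`, for nonempty `w`. -/
def letterWord (w : List X) : FreeWords L := if w = [] then 0 else word [Ψ w]

theorem comorphism_eq {n : ℕ} {w : List X} (hw : w.length = n) :
    comorphism Ψ w = ∑ c : Composition n, word (blockWord Ψ c.blocks w) := by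
  subst hw; rfl

theorem comorphism_nil : comorphism Ψ [] = 1 := by
  have : ∀ c : Composition 0, c.blocks = [] := fun c => by simp
  rw [comorphism_eq Ψ (n := 0) rfl]
  simp [this, blockWord, word_nil, composition_card]

theorem comorphism_cons (x : X) (w : List X) :
    comorphism Ψ (x :: w) = splitSum (fun u v => word [Ψ (x :: u)] * comorphism Ψ v) w := by
  rw [comorphism_eq Ψ (n := w.length + 1) rfl,
    sum_composition_succ w.length fun bs => word (blockWord Ψ bs (x :: w)), splitSum_eq_sum]
  refine Finset.sum_congr rfl fun m _ => ?_
  rw [comorphism_eq Ψ (w := w.drop m) (List.length_drop), Finset.mul_sum]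
  refine Finset.sum_congr rfl fun c _ => ?_
  rw [← word_append]
  rfl

/-- Splitting off the first block: `F = 1 + Ψ * F`, so `F` is the geometric series of `Ψ` under
convolution. Both sides are functions on words, so this recursion can stand in for sums over
compositions. -/
theorem comorphism_eq_add :
    comorphism Ψ = convOne + conv (letterWord Ψ) (comorphism Ψ) := by
  funext w
  cases w with
  | nil => simp [comorphism_nil, convOne, conv, splitSum, letterWord]
  | cons x w => simp [comorphism_cons, convOne, conv, splitSum, letterWord]

/-- Because `f [] = 0`, the term `conv f k` at `w` only sees `k` on shorter words, so the recursion
determines its solution. -/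
theorem eq_of_conv_recursion [Ring R] {f g k k' : List X → R} (hf : f [] = 0)
    (hk : k = g + conv f k) (hk' : k' = g + conv f k') : k = k' := by
  funext w
  induction hn : w.length using Nat.strong_induction_on generalizing w with
  | _ n ih =>
    rw [hk, hk', Pi.add_apply, Pi.add_apply, conv, conv]
    congr 1
    refine splitSum_congr w fun u v huv => ?_
    rcases u with _ | ⟨x, u⟩
    · rw [hf, zero_mul, zero_mul]
    · rw [ih v.length (by rw [← hn, ← huv]; simp) v rfl]

/-- The Leibniz rule applied to `F = 1 + Ψ * F` gives `DF = DΨ * F + Ψ^± * DF`. The right-hand side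
solves the same recursion, since `F^± = 1 + Ψ^± * F^±`. -/
theorem wordDer_comorphism (b : List X → X) {sg : List X → ℤˣ}
    (hsg : ∀ u v, sg (u ++ v) = sg u * sg v) :
    wordDer b sg (comorphism Ψ) =
      conv (signed sg (comorphism Ψ)) (conv (wordDer b sg (letterWord Ψ)) (comorphism Ψ)) := by
  have h_one : sg [] = 1 := by simpa using hsg [] []
  refine eq_of_conv_recursion (f := signed sg (letterWord Ψ))
    (g := conv (wordDer b sg (letterWord Ψ)) (comorphism Ψ)) (by simp [signed, letterWord]) ?_ ?_
  · conv_lhs => rw [comorphism_eq_add]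
    rw [wordDer_add, wordDer_convOne, zero_add, wordDer_conv b hsg]
  · have h1 : signed sg (comorphism Ψ) =
        convOne + conv (signed sg (letterWord Ψ)) (signed sg (comorphism Ψ)) := by
      conv_lhs => rw [comorphism_eq_add]
      rw [← signed_conv hsg]
      funext w
      by_cases hw : w = [] <;> simp [signed, convOne, hw, h_one]
    conv_lhs => rw [h1, add_conv, convOne_conv, conv_assoc]

theorem wordLift_comorphism_cons [AddCommGroup M] (f : List L → M) (x : X) (w : List X) :
    wordLift f (comorphism Ψ (x :: w)) =
      splitSum (fun u v => wordLift (fun l => f (Ψ (x :: u) :: l)) (comorphism Ψ v)) w := by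
  rw [comorphism_cons, map_splitSum]
  simp only [wordLift_word_mul]
  rfl

theorem wordLift_comorphism_nil [AddCommGroup M] (f : List L → M) :
    wordLift f (comorphism Ψ []) = f [] := by
  rw [comorphism_nil, ← word_nil, wordLift_word]

/-- Precomposition with a coalgebra morphism respects convolution. The induction varies `f`, since
peeling off the first letter `a` replaces `f` by `f (a :: ·)`. -/
theorem wordLift_conv_comorphism [Ring R] (f g : List L → R) (w : List X) :
    wordLift (conv f g) (comorphism Ψ w) =
      conv (fun u => wordLift f (comorphism Ψ u)) (fun u => wordLift g (comorphism Ψ u)) w := by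
  induction hn : w.length using Nat.strong_induction_on generalizing w f with
  | _ n ih =>
    cases w with
    | nil => simp [wordLift_comorphism_nil, conv, splitSum]
    | cons x w =>
      have h1 : ∀ a : L, (fun l => conv f g (a :: l)) =
          fun l => AddMonoidHom.mulLeft (f []) (g (a :: l)) + conv (fun l => f (a :: l)) g l :=
        fun a => rfl
      rw [wordLift_comorphism_cons]
      simp only [h1, wordLift_add, wordLift_comp, splitSum_add]
      rw [← map_splitSum, ← wordLift_comorphism_cons, conv, splitSum, wordLift_comorphism_nil]
      congr 1
      simp only [wordLift_comorphism_cons, splitSum_mul]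
      rw [splitSum_assoc (fun a b v => wordLift (fun l => f (Ψ (x :: a) :: l)) (comorphism Ψ b) *
        wordLift g (comorphism Ψ v))]
      refine splitSum_congr w fun u v huv => ?_
      rw [ih v.length (by rw [← hn, ← huv]; simp) _ v rfl, conv]

theorem forall_mem_blockWord {Q : X → Prop} {P : L → Prop}
    (hΨ : ∀ u, u ≠ [] → (∀ x ∈ u, Q x) → P (Ψ u)) {bs : List ℕ} {w : List X}
    (hbs : ∀ k ∈ bs, 0 < k) (hsum : bs.sum = w.length) (hw : ∀ x ∈ w, Q x) :
    ∀ a ∈ blockWord Ψ bs w, P a := by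
  induction bs generalizing w with
  | nil => simp [blockWord]
  | cons k bs ih =>
    have hk := hbs k (by simp)
    rw [List.sum_cons] at hsum
    intro a ha
    rcases List.mem_cons.1 ha with rfl | ha
    · refine hΨ _ ?_ fun x hx => hw x (List.mem_of_mem_take hx)
      intro h0
      rcases List.take_eq_nil_iff.1 h0 with h0 | rfl
      · omega
      · rw [List.length_nil] at hsum
        omega
    · exact ih (fun k hk => hbs k (List.mem_cons_of_mem _ hk)) (by simp; omega)
        (fun x hx => hw x (List.mem_of_mem_drop hx)) a ha

/-- Carries identities known only for homogeneous letters through `F`: `Q` and `P` will say that the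
value of a letter lies in the degree it records. -/
theorem wordLift_comorphism_eq_zero [AddCommGroup M] {f : List L → M} {Q : X → Prop} {P : L → Prop}
    (hΨ : ∀ u, u ≠ [] → (∀ x ∈ u, Q x) → P (Ψ u)) (hf : ∀ l, (∀ a ∈ l, P a) → f l = 0)
    {w : List X} (hw : ∀ x ∈ w, Q x) : wordLift f (comorphism Ψ w) = 0 := by
  rw [comorphism, map_sum]
  refine Finset.sum_eq_zero fun c _ => ?_
  rw [wordLift_word]
  exact hf _ (forall_mem_blockWord Ψ hΨ (fun k hk => c.blocks_pos hk) c.blocks_sum hw)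

end FreeWords

/-! ### Letters with weight and degree, suspension signs, and operations on words -/

section Letter

variable {A : Type*}

/-- An element of a graded vector space, with a weight `wt` and a degree `dg`. A letter of weight
`k` and value `a` stands for the element `α ^ (-k) a`. -/
@[ext] structure Letter (A : Type*) where
  /-- The underlying element. -/
  val : A
  /-- The weight. -/
  wt : ℕ
  /-- The degree. -/
  dg : ℤ

/-- The total weight of a word. -/
def wtSum (w : List (Letter A)) : ℕ := (w.map Letter.wt).sum

/-- The total degree of a word in the suspension. -/
def susDeg (w : List (Letter A)) : ℤ := (w.map fun x => x.dg + 1).sum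

/-- The exponent of the sign of the suspension isomorphism. -/
def susExp : List (Letter A) → ℤ
  | [] => 0
  | x :: w => w.length * (x.dg + 1) + susExp w

/-- The Koszul sign of moving a map of degree `-1` past a word in the suspension. -/
def wordSign (w : List (Letter A)) : ℤˣ := Int.negOnePow (susDeg w)

theorem wtSum_append (u v : List (Letter A)) : wtSum (u ++ v) = wtSum u + wtSum v := by
  simp [wtSum]

theorem wtSum_cons (x : Letter A) (v : List (Letter A)) : wtSum (x :: v) = x.wt + wtSum v := by
  simp [wtSum]

theorem susDeg_append (u v : List (Letter A)) : susDeg (u ++ v) = susDeg u + susDeg v := by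
  simp [susDeg]

theorem susDeg_cons (x : Letter A) (v : List (Letter A)) :
    susDeg (x :: v) = (x.dg + 1) + susDeg v := by
  simp [susDeg]

theorem wordSign_append (u v : List (Letter A)) :
    wordSign (u ++ v) = wordSign u * wordSign v := by
  rw [wordSign, susDeg_append, Int.negOnePow_add]; rfl

/-- Each letter of `u` gains `v.length` further letters to its right. -/
theorem susExp_append (u v : List (Letter A)) :
    susExp (u ++ v) = susExp u + v.length * susDeg u + susExp v := by
  induction u with
  | nil => simp [susExp, susDeg]
  | cons x u ih =>
    simp only [List.cons_append, susExp, ih, List.length_append, susDeg_cons]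
    push_cast
    ring

theorem wt_le_wtSum {x : Letter A} {w : List (Letter A)} (hx : x ∈ w) : x.wt ≤ wtSum w :=
  List.le_sum_of_mem (List.mem_map_of_mem hx)

end Letter

section Letters

variable {K : Type*} [Field K]
variable {A : Type*} [AddCommGroup A] [Module K A]
variable {B : Type*} [AddCommGroup B] [Module K B]
variable {M : Type*} [AddCommGroup M] [Module K M]

section EvalList

variable (ν : ∀ k : ℕ, MultilinearMap K (fun _ : Fin k => A) M)

/-- Evaluate a family of multilinear maps on a list. -/
def evalList (l : List A) : M := ν l.length fun q : Fin l.length => l[(q : ℕ)]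

theorem evalList_eq {l : List A} {n : ℕ} (hl : l.length = n) (g : ℕ → A)
    (hg : ∀ (q : ℕ) (hq : q < l.length), l[q] = g q) : evalList ν l = ν n fun q => g q := by
  subst hl
  exact congrArg _ (funext fun q : Fin l.length => hg q q.2)

theorem evalList_append_cons_add (u : List A) (x y : A) (v : List A) :
    evalList ν (u ++ (x + y) :: v) = evalList ν (u ++ x :: v) + evalList ν (u ++ y :: v) := by
  have key : ∀ z : A, evalList ν (u ++ z :: v) = ν (u.length + (v.length + 1))
      (Function.update (fun q => (u ++ (0 : A) :: v).getD q 0)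
        ⟨u.length, by omega⟩ z) := by
    intro z
    rw [evalList_eq ν (n := u.length + (v.length + 1)) (by simp)
      (fun q => if q = u.length then z else (u ++ (0 : A) :: v).getD q 0)]
    · congr 1
      funext q
      simp [Function.update_apply, Fin.ext_iff]
    · intro q hq
      simp only [List.length_append, List.length_cons] at hq
      split_ifs with h
      · subst h
        simp
      · rw [List.getD_eq_getElem _ _ (by simpa using hq), List.getElem_append, List.getElem_append]
        split_ifs with h'
        · rfl
        · obtain ⟨k, rfl⟩ : ∃ k, q = u.length + (k + 1) := ⟨q - u.length - 1, by omega⟩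
          simp
  rw [key, key, key, MultilinearMap.map_update_add]

/-- Evaluation of a family of multilinear maps on a list, as a function of one of its entries. -/
def evalHom (u v : List A) : A →+ M :=
  AddMonoidHom.mk' (fun x => evalList ν (u ++ x :: v)) fun x y => evalList_append_cons_add ν u x y v

theorem evalHom_apply (u v : List A) (x : A) : evalHom ν u v x = evalList ν (u ++ x :: v) := rfl

theorem map_evalList {N : Type*} [AddCommGroup N] [Module K N]
    (ν' : ∀ k : ℕ, MultilinearMap K (fun _ : Fin k => B) N) (f : M →ₗ[K] N) (g : A → B)
    (hf : ∀ k : ℕ, 1 ≤ k → ∀ a : Fin k → A, f (ν k a) = ν' k fun j => g (a j))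
    {l : List A} (hl : l ≠ []) : f (evalList ν l) = evalList ν' (l.map g) := by
  rw [evalList, hf _ (List.length_pos_of_ne_nil hl), evalList_eq ν' (l := l.map g) (n := l.length)
    (by simp) fun q => if h : q < l.length then g l[q] else 0]
  · simp
  · intro q hq
    simp only [List.length_map] at hq
    simp [hq]

end EvalList

/-- The values of the letters of a word, brought to the common weight `W`. -/
def scaled (α : A →ₗ[K] A) (W : ℕ) (w : List (Letter A)) : List A :=
  w.map fun x => (α ^ (W - x.wt)) x.val

/-- The operation on words induced by a family of multilinear maps. -/
def wordOp (ν : ∀ k : ℕ, MultilinearMap K (fun _ : Fin k => A) M) (α : A →ₗ[K] A)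
    (w : List (Letter A)) : M :=
  Int.negOnePow (susExp w) • evalList ν (scaled α (wtSum w) w)

/-- The letter with value `f w`, if `f` is an operation which has degree `e` in the suspension. -/
def opLetter (f : List (Letter A) → B) (e : ℤ) (w : List (Letter A)) : Letter B :=
  ⟨f w, wtSum w + (w.length - 1), susDeg w + e - 1⟩

theorem length_scaled (α : A →ₗ[K] A) (W : ℕ) (w : List (Letter A)) :
    (scaled α W w).length = w.length := by
  simp [scaled]

theorem pow_apply_pow_apply (α : A →ₗ[K] A) (m n : ℕ) (x : A) :
    (α ^ m) ((α ^ n) x) = (α ^ (m + n)) x := by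
  rw [pow_add]; rfl

theorem map_scaled (α : A →ₗ[K] A) {W : ℕ} (k : ℕ) {w : List (Letter A)}
    (hW : ∀ x ∈ w, x.wt ≤ W) : (scaled α W w).map (α ^ k) = scaled α (W + k) w := by
  simp only [scaled, List.map_map, List.map_inj_left]
  intro x hx
  have := hW x hx
  simp only [Function.comp_apply, pow_apply_pow_apply]
  congr 2
  omega

theorem pow_comm_multi {ν : ∀ k : ℕ, MultilinearMap K (fun _ : Fin k => A) M} {α : A →ₗ[K] A}
    {β : M →ₗ[K] M}
    (hν : ∀ k : ℕ, 1 ≤ k → ∀ a : Fin k → A, β (ν k a) = ν k fun j => α (a j)) (n : ℕ) :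
    ∀ k : ℕ, 1 ≤ k → ∀ a : Fin k → A, (β ^ n) (ν k a) = ν k fun j => (α ^ n) (a j) := by
  induction n with
  | zero => intro k _ a; rfl
  | succ n ih =>
    intro k hk a
    simp only [pow_succ', Module.End.mul_apply]
    rw [ih k hk, hν k hk]

/-- Multiplicativity absorbs `β ^ n` into the arguments, as a common weight larger by `n`. -/
theorem pow_wordOp {ν : ∀ k : ℕ, MultilinearMap K (fun _ : Fin k => A) M} {α : A →ₗ[K] A}
    {β : M →ₗ[K] M}
    (hν : ∀ k : ℕ, 1 ≤ k → ∀ a : Fin k → A, β (ν k a) = ν k fun j => α (a j)) (n : ℕ)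
    {w : List (Letter A)} (hw : w ≠ []) :
    (β ^ n) (wordOp ν α w) =
      Int.negOnePow (susExp w) • evalList ν (scaled α (wtSum w + n) w) := by
  rw [wordOp, Units.smul_def, map_zsmul, ← map_scaled α n fun x hx => wt_le_wtSum hx,
    map_evalList ν ν (β ^ n) (fun x => (α ^ n) x) (pow_comm_multi hν n) (by simpa [scaled] using hw)]
  rfl

/-- `wordOp ν α`, as a function of the value of one of the letters. -/
def wordOpHom (ν : ∀ k : ℕ, MultilinearMap K (fun _ : Fin k => A) M) (α : A →ₗ[K] A)
    (u v : List (Letter A)) (k : ℕ) (e : ℤ) : A →+ M :=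
  Int.negOnePow (susExp (u ++ ⟨(0 : A), k, e⟩ :: v)) •
    (evalHom ν (scaled α (wtSum u + (k + wtSum v)) u) (scaled α (wtSum u + (k + wtSum v)) v)).comp
      (α ^ (wtSum u + wtSum v)).toAddMonoidHom

theorem wordOpHom_apply (ν : ∀ k : ℕ, MultilinearMap K (fun _ : Fin k => A) M) (α : A →ₗ[K] A)
    (u v : List (Letter A)) (k : ℕ) (e : ℤ) (x : A) :
    wordOpHom ν α u v k e x = wordOp ν α (u ++ ⟨x, k, e⟩ :: v) := by
  rw [wordOp, wtSum_append, wtSum_cons]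
  have h1 : susExp (u ++ ⟨x, k, e⟩ :: v) = susExp (u ++ ⟨(0 : A), k, e⟩ :: v) := by
    simp only [susExp_append, susExp, List.length_cons]
  have h2 : wtSum u + (k + wtSum v) - k = wtSum u + wtSum v := by omega
  rw [h1, scaled, List.map_append, List.map_cons]
  simp only [h2]
  rfl

/-- Passes from cutting `w` at positions `r` and `r + i` to the indexing of the structure
identities, with `r = l - 1`. The terms `i = 0` belong to an empty middle word. -/
theorem sum_split_reindex (n : ℕ) (G : ℕ → ℕ → M) :
    ∑ r ∈ Finset.range (n + 1), ∑ i ∈ Finset.range (n - r + 1), (if i = 0 then 0 else G r i) =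
      ∑ i ∈ Finset.Icc 1 n, ∑ l ∈ Finset.Icc 1 (n + 1 - i), G (l - 1) i := by
  have h1 : ∀ r, ∑ i ∈ Finset.range (n - r + 1), (if i = 0 then 0 else G r i) =
      ∑ i ∈ Finset.Icc 1 (n - r), G r i := by
    intro r
    have h0 : ∀ i, (if i = 0 then 0 else G r i) = if i ≠ 0 then G r i else 0 := fun i =>
      (ite_not _ _ _).symm
    simp only [h0, ← Finset.sum_filter]
    refine Finset.sum_congr ?_ fun _ _ => rfl
    ext i
    simp only [Finset.mem_filter, Finset.mem_range, Finset.mem_Icc]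
    omega
  have h2 : ∀ i, ∑ l ∈ Finset.Icc 1 (n + 1 - i), G (l - 1) i =
      ∑ r ∈ Finset.range (n + 1 - i), G r i := by
    intro i
    have h3 : Finset.Icc 1 (n + 1 - i) = Finset.Ico (0 + 1) (n + 1 - i + 1) := by
      ext
      simp only [Finset.mem_Icc, Finset.mem_Ico]
      omega
    rw [Finset.range_eq_Ico, h3, ← Finset.sum_Ico_add' (fun l => G (l - 1) i)]
    rfl
  simp only [h1, h2]
  refine Finset.sum_comm' fun r i => ?_
  simp only [Finset.mem_range, Finset.mem_Icc]
  omega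

end Letters

/-- Compares the bar sign with the sign of the structure identities. They differ by a factor
depending only on the whole word `u ++ m ++ v`, which can therefore be taken out of the sum. -/
theorem susExp_insert {A : Type*} (u m v : List (Letter A)) {x : Letter A} (hx : x.dg = susDeg m + -1 - 1)
    {S : ℤ} (hS : susDeg u = S + u.length) :
    wordSign u * (Int.negOnePow (susExp (u ++ x :: v)) * Int.negOnePow (susExp m)) =
      Int.negOnePow (susExp (u ++ m ++ v) + (u ++ m ++ v).length + 1) *
        Int.negOnePow (((u.length + 1 : ℕ) : ℤ) * (m.length + 1) + m.length * S) := by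
  rw [wordSign, ← Int.negOnePow_add, ← Int.negOnePow_add, ← Int.negOnePow_add,
    Int.negOnePow_eq_iff]
  simp only [susExp_append, susExp, hx, List.length_append, List.length_cons, susDeg_append, hS]
  push_cast
  -- The witness is half the difference of the two exponents.
  refine ⟨S + u.length - m.length * S - m.length * u.length - m.length - v.length - u.length - 1, ?_⟩
  ring

/-! ### The structure identities in the bar construction -/

section BarIdentity

variable {K : Type*} [Field K]
variable {A : Type*} [AddCommGroup A] [Module K A]
variable {μ : ∀ k : ℕ, MultilinearMap K (fun _ : Fin k => A) A} {α : A →ₗ[K] A}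

/-- Source of the powers `α^{i-1}`: contracting `m` raises the total weight from `W` to `W +
(m.length - 1)`, so letters of `u` and `v` receive that many extra copies of `α`. The new letter
already has this extra weight, and the power it still needs brings the arguments of the inner
operation exactly to weight `W`. -/
theorem wordOp_insert (hμ : ∀ k : ℕ, 1 ≤ k → ∀ a : Fin k → A, α (μ k a) = μ k fun j => α (a j))
    {u m v : List (Letter A)} (hm : m ≠ []) {W : ℕ} (hW : W = wtSum (u ++ m ++ v)) :
    wordOp μ α (u ++ opLetter (wordOp μ α) (-1) m :: v) =
      (Int.negOnePow (susExp (u ++ opLetter (wordOp μ α) (-1) m :: v)) * Int.negOnePow (susExp m)) •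
        evalList μ (((scaled α W u).map fun x => (α ^ (m.length - 1)) x) ++
          evalList μ (scaled α W m) :: ((scaled α W v).map fun x => (α ^ (m.length - 1)) x)) := by
  simp only [wtSum_append] at hW
  have hWu : ∀ x ∈ u, x.wt ≤ W := fun x hx => by have := wt_le_wtSum hx; omega
  have hWv : ∀ x ∈ v, x.wt ≤ W := fun x hx => by have := wt_le_wtSum hx; omega
  have h1 : wtSum (u ++ opLetter (wordOp μ α) (-1) m :: v) = W + (m.length - 1) := by
    simp only [wtSum_append, wtSum_cons, opLetter]
    omega
  have h2 : W + (m.length - 1) - (opLetter (wordOp μ α) (-1) m).wt = wtSum u + wtSum v := by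
    simp only [opLetter]
    omega
  have h3 : wtSum m + (wtSum u + wtSum v) = W := by omega
  conv_lhs => rw [wordOp, h1]
  rw [map_scaled α _ hWu, map_scaled α _ hWv, mul_smul]
  congr 1
  have h4 : scaled α (W + (m.length - 1)) (u ++ opLetter (wordOp μ α) (-1) m :: v) =
      scaled α (W + (m.length - 1)) u ++ (Int.negOnePow (susExp m) • evalList μ (scaled α W m)) ::
        scaled α (W + (m.length - 1)) v := by
    rw [scaled, List.map_append, List.map_cons, h2, ← h3, ← pow_wordOp hμ _ hm]
    rfl
  rw [h4, ← evalHom_apply, ← evalHom_apply, Units.smul_def, map_zsmul, Units.smul_def]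

theorem evalList_insertArgs {u m v : List A} (hm : m ≠ []) {i r n : ℕ} (hi : m.length = i)
    (hr : u.length = r) (hn : r + v.length + 1 = n) {a : ℕ → A}
    (ha : ∀ (q : ℕ) (hq : q < (u ++ m ++ v).length), (u ++ m ++ v)[q] = a q) :
    evalList μ ((u.map fun x => (α ^ (i - 1)) x) ++
      evalList μ m :: (v.map fun x => (α ^ (i - 1)) x)) =
      μ n (fun q => insertArgs μ α i r a q) := by
  subst hi hr hn
  have hpos := List.length_pos_of_ne_nil hm
  simp only [List.length_append] at ha
  refine evalList_eq μ (by simp; omega) (fun q => insertArgs μ α m.length u.length a q) ?_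
  intro q hq
  simp only [List.length_append, List.length_map, List.length_cons] at hq
  rw [insertArgs]
  split_ifs with h1 h2
  · rw [← ha q (by omega), List.getElem_append_left (by simpa using h1)]
    simp [List.getElem_append_left, h1]
  · subst h2
    rw [List.getElem_append_right (by simp)]
    simp only [List.length_map, Nat.sub_self, List.getElem_cons_zero]
    refine evalList_eq μ rfl (fun q => a (u.length + q)) fun q hq' => ?_
    rw [← ha _ (by omega), List.getElem_append_left (by simpa using hq')]
    simp
  · obtain ⟨k, rfl⟩ : ∃ k, q = u.length + (k + 1) := ⟨q - u.length - 1, by omega⟩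
    have h3 : u.length + (k + 1) + m.length - 1 = u.length + m.length + k := by omega
    simp only [h3]
    rw [← ha _ (by omega), List.getElem_append_right (by simp),
      List.getElem_append_right (by simp)]
    simp

/-- The defining identities of an `HA_∞`-algebra, in the suspension. -/
theorem wordDer_wordOp (hμ : ∀ k : ℕ, 1 ≤ k → ∀ a : Fin k → A, α (μ k a) = μ k fun j => α (a j))
    (w : List (Letter A)) {a : ℕ → A} {d : ℕ → ℤ}
    (ha : ∀ (q : ℕ) (hq : q < w.length), (α ^ (wtSum w - w[q].wt)) w[q].val = a q)
    (hd : ∀ (q : ℕ) (hq : q < w.length), w[q].dg = d q) :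
    wordDer (opLetter (wordOp μ α) (-1)) wordSign (wordOp μ α) w =
      Int.negOnePow (susExp w + w.length + 1) •
      ∑ i ∈ Finset.Icc 1 w.length, ∑ l ∈ Finset.Icc 1 (w.length + 1 - i),
        Int.negOnePow ((l : ℤ) * (i + 1) + i * ∑ m ∈ Finset.range (l - 1), d m) •
          μ (w.length + 1 - i) (fun q => insertArgs μ α i (l - 1) a q) := by
  have hsum : ∀ (u v : List (Letter A)), w = u ++ v →
      susDeg u = ∑ m ∈ Finset.range u.length, d m + u.length := by
    rintro u v rfl
    have h1 : susDeg u = ∑ q : Fin u.length, (u[(q : ℕ)].dg + 1) := by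
      rw [susDeg, ← Fin.sum_univ_fun_getElem]
    rw [h1, Finset.sum_add_distrib, ← Fin.sum_univ_eq_sum_range]
    congr 1
    · refine Finset.sum_congr rfl fun q _ => ?_
      rw [← hd q (by simp; omega), List.getElem_append_left]
    · simp
  -- Writing `l` as `l - 1 + 1` makes every summand a function of `r = l - 1`.
  have h1 : ∀ i l : ℕ, i ∈ Finset.Icc 1 w.length → l ∈ Finset.Icc 1 (w.length + 1 - i) →
      Int.negOnePow ((l : ℤ) * (i + 1) + i * ∑ m ∈ Finset.range (l - 1), d m) •
          μ (w.length + 1 - i) (fun q => insertArgs μ α i (l - 1) a q) =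
      Int.negOnePow (((l - 1 + 1 : ℕ) : ℤ) * (i + 1) + i * ∑ m ∈ Finset.range (l - 1), d m) •
          μ (w.length + 1 - i) (fun q => insertArgs μ α i (l - 1) a q) := by
    intro i l _ hl
    rw [Nat.sub_add_cancel (Finset.mem_Icc.1 hl).1]
  rw [Finset.sum_congr rfl fun i hi => Finset.sum_congr rfl fun l hl => h1 i l hi hl,
    ← sum_split_reindex w.length fun r i =>
      Int.negOnePow (((r + 1 : ℕ) : ℤ) * (i + 1) + i * ∑ m ∈ Finset.range r, d m) •
          μ (w.length + 1 - i) (fun q => insertArgs μ α i r a q), wordDer, splitSum_eq_sum,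
    Finset.smul_sum]
  refine Finset.sum_congr rfl fun r hr => ?_
  have hr' := Finset.mem_range.1 hr
  rw [splitSum_eq_sum, Finset.smul_sum, List.length_drop]
  refine Finset.sum_congr rfl fun i hi => ?_
  have hi' := Finset.mem_range.1 hi
  obtain ⟨u, y, rfl, rfl⟩ : ∃ u y, w = u ++ y ∧ r = u.length :=
    ⟨w.take r, w.drop r, by simp, by simp; omega⟩
  simp only [List.length_append, Nat.add_sub_cancel_left, List.take_left', List.drop_left'] at *
  obtain ⟨m, v, rfl, rfl⟩ : ∃ m v, y = m ++ v ∧ i = m.length :=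
    ⟨y.take i, y.drop i, by simp, by simp; omega⟩
  simp only [List.take_left', List.drop_left', List.length_eq_zero_iff]
  split_ifs with hm
  · simp
  · have key := evalList_insertArgs (μ := μ) (α := α) (u := scaled α (wtSum (u ++ (m ++ v))) u)
      (m := scaled α (wtSum (u ++ (m ++ v))) m) (v := scaled α (wtSum (u ++ (m ++ v))) v)
      (by simpa [scaled] using hm) (length_scaled _ _ _) (length_scaled _ _ _)
      (n := (u ++ (m ++ v)).length + 1 - m.length)
      (by simp only [length_scaled, List.length_append]; omega) (a := a) (by
        intro q hq
        simp only [scaled, ← List.map_append, List.append_assoc, List.length_map] at hq ⊢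
        rw [List.getElem_map]
        exact ha q (by simpa using hq))
    rw [wordOp_insert hμ hm rfl, ← mul_smul,
      susExp_insert u m v rfl (hsum u _ rfl), mul_smul, List.append_assoc, key, List.length_append]

end BarIdentity

/-! ### Koszul signs and the cutting of words into blocks -/

theorem map_units_smul_univ {K A M : Type*} [Field K] [AddCommGroup A] [Module K A]
    [AddCommGroup M] [Module K M] {k : ℕ} (f : MultilinearMap K (fun _ : Fin k => A) M)
    (ε : Fin k → ℤˣ) (a : Fin k → A) : f (fun j => ε j • a j) = (∏ j, ε j) • f a := by
  have h1 : ∀ (e : ℤˣ) (x : A), e • x = ((e : ℤ) : K) • x := fun e x => by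
    rw [Units.smul_def, Int.cast_smul_eq_zsmul]
  simp only [h1, MultilinearMap.map_smul_univ, Units.smul_def]
  rw [← Int.cast_smul_eq_zsmul K]
  push_cast
  rfl

theorem negOnePow_sum {ι : Type*} (s : Finset ι) (f : ι → ℤ) :
    Int.negOnePow (∑ j ∈ s, f j) = ∏ j ∈ s, Int.negOnePow (f j) := by
  classical
  induction s using Finset.induction_on with
  | empty => simp
  | insert a s ha ih => rw [Finset.sum_insert ha, Finset.prod_insert ha, Int.negOnePow_add, ih]

section Koszul

variable {K : Type*} [Field K] {A : Type*} [AddCommGroup A] [Module K A]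
variable (𝒜 : ℤ → Submodule K A) [DirectSum.Decomposition 𝒜]

theorem koszul_pow_of_mem {n : ℤ} {a : A} (ha : a ∈ 𝒜 n) (k : ℕ) :
    (koszul 𝒜 ^ k) a = Int.negOnePow (k * n) • a := by
  induction k with
  | zero => simp
  | succ k ih =>
    rw [pow_succ', Module.End.mul_apply, ih, Units.smul_def, map_zsmul, koszul_of_mem 𝒜 ha,
      ← Units.smul_def, ← mul_smul, ← Int.negOnePow_add]
    congr 2
    push_cast
    ring

theorem koszul_comm {α : A →ₗ[K] A} (hα : IsLinOfDegree 𝒜 𝒜 α 0) (a : A) :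
    α (koszul 𝒜 a) = koszul 𝒜 (α a) := by
  induction a using DirectSum.Decomposition.inductionOn 𝒜 with
  | zero => simp
  | @homogeneous n m =>
    have h1 : α m ∈ 𝒜 n := by simpa using hα n m m.2
    rw [koszul_of_mem 𝒜 m.2, koszul_of_mem 𝒜 h1, Units.smul_def, map_zsmul]
    rfl
  | add x y hx hy => simp only [map_add, hx, hy]

theorem koszul_pow_comm {α : A →ₗ[K] A} (hα : IsLinOfDegree 𝒜 𝒜 α 0) (k : ℕ) (a : A) :
    α ((koszul 𝒜 ^ k) a) = (koszul 𝒜 ^ k) (α a) := by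
  have h1 : Commute α (koszul 𝒜) := LinearMap.ext fun a => koszul_comm 𝒜 hα a
  exact LinearMap.congr_fun (h1.pow_right k).eq a

theorem koszul_pow_mem {n : ℤ} {a : A} (ha : a ∈ 𝒜 n) (k : ℕ) : (koszul 𝒜 ^ k) a ∈ 𝒜 n := by
  rw [koszul_pow_of_mem 𝒜 ha, Units.smul_def]
  exact zsmul_mem ha _

omit [DirectSum.Decomposition 𝒜] in
theorem pow_mem_of_degree_zero {α : A →ₗ[K] A} (hα : IsLinOfDegree 𝒜 𝒜 α 0) {n : ℤ} {a : A}
    (ha : a ∈ 𝒜 n) (k : ℕ) : (α ^ k) a ∈ 𝒜 n := by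
  induction k with
  | zero => exact ha
  | succ k ih =>
    rw [pow_succ', Module.End.mul_apply]
    simpa using hα n _ ih

end Koszul

section Blocks

variable {A X L : Type*}

/-- The block number `s` of a word, cut into blocks of the given lengths. -/
def wordBlock (bs : List ℕ) (w : List X) (s : Fin bs.length) : List X :=
  (w.drop (bs.take s).sum).take bs[(s : ℕ)]

theorem getElem_blockWord (Ψ : List X → L) (bs : List ℕ) (w : List X) (s : Fin bs.length) :
    (blockWord Ψ bs w)[(s : ℕ)]'(by rw [length_blockWord]; exact s.2) = Ψ (wordBlock bs w s) := by
  obtain ⟨s, hs⟩ := s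
  induction bs generalizing w s with
  | nil => simp at hs
  | cons k bs ih =>
    cases s with
    | zero => simp [blockWord, wordBlock]
    | succ s =>
      have := ih (w.drop k) s (by simpa using hs)
      simp only [blockWord, List.getElem_cons_succ, this, wordBlock, List.take_succ_cons,
        List.sum_cons, List.drop_drop]

theorem sum_add_take_le (bs : List ℕ) (s : Fin bs.length) :
    (bs.take s).sum + bs[(s : ℕ)] ≤ bs.sum := by
  rw [← List.sum_take_succ]
  exact (List.take_sublist _ _).sum_le_sum (fun _ _ => Nat.zero_le _)

theorem length_wordBlock {bs : List ℕ} {w : List X} (hw : bs.sum = w.length) (s : Fin bs.length) :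
    (wordBlock bs w s).length = bs[(s : ℕ)] := by
  have := sum_add_take_le bs s
  simp only [wordBlock, List.length_take, List.length_drop]
  omega

theorem sum_wordBlock_cons {M : Type*} [AddCommMonoid M] (k : ℕ) (bs : List ℕ) (w : List X)
    (F : List X → ℤ → M) :
    ∑ s : Fin (k :: bs).length, F (wordBlock (k :: bs) w s)
        (∑ t ∈ Finset.Ioi s, (((k :: bs)[(t : ℕ)] : ℤ) - 1)) =
      F (w.take k) (∑ t : Fin bs.length, ((bs[(t : ℕ)] : ℤ) - 1)) +
      ∑ s : Fin bs.length, F (wordBlock bs (w.drop k) s)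
        (∑ t ∈ Finset.Ioi s, ((bs[(t : ℕ)] : ℤ) - 1)) := by
  refine (Fin.sum_univ_succ (n := bs.length) _).trans ?_
  congr 1
  · refine congrArg₂ F (by simp [wordBlock]) ?_
    exact Fin.sum_Ioi_zero (fun t : Fin (bs.length + 1) => ((k :: bs)[(t : ℕ)] : ℤ) - 1)
  · refine Finset.sum_congr rfl fun s _ => ?_
    refine congrArg₂ F (by simp [wordBlock, List.drop_drop]) ?_
    exact Fin.sum_Ioi_succ (fun t : Fin (bs.length + 1) => ((k :: bs)[(t : ℕ)] : ℤ) - 1) s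

theorem sum_sub_one (bs : List ℕ) :
    ∑ t : Fin bs.length, ((bs[(t : ℕ)] : ℤ) - 1) = bs.sum - bs.length := by
  rw [Finset.sum_sub_distrib]
  simp [← Nat.cast_sum]

/-- A letter of block `s` has `bs[t]` letters of each later block `t` to its right. One of them is
accounted for by the letter that replaces block `t`; the remaining `bs[t] - 1` give the correction
term. -/
theorem susExp_blockWord {Ψ : List (Letter X) → Letter A}
    (hΨ : ∀ u, (Ψ u).dg = susDeg u - 1) {bs : List ℕ} {w : List (Letter X)}
    (hw : bs.sum = w.length) :
    susExp w = susExp (blockWord Ψ bs w) + ∑ s : Fin bs.length, (susExp (wordBlock bs w s) +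
      susDeg (wordBlock bs w s) * ∑ t ∈ Finset.Ioi s, ((bs[(t : ℕ)] : ℤ) - 1)) := by
  induction bs generalizing w with
  | nil =>
    obtain rfl : w = [] := List.length_eq_zero_iff.1 (by simpa using hw.symm)
    simp [susExp, blockWord]
  | cons k bs ih =>
    rw [List.sum_cons] at hw
    have hw' : bs.sum = (w.drop k).length := by rw [List.length_drop]; omega
    rw [sum_wordBlock_cons k bs w fun u z => susExp u + susDeg u * z, sum_sub_one, blockWord, susExp,
      length_blockWord, hΨ]
    conv_lhs => rw [← List.take_append_drop k w, susExp_append, ih hw', ← hw']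
    ring

theorem wtSum_blockWord {Ψ : List (Letter X) → Letter A}
    (hΨ : ∀ u, (Ψ u).wt = wtSum u + (u.length - 1)) {bs : List ℕ} {w : List (Letter X)}
    (hw : bs.sum = w.length) :
    wtSum (blockWord Ψ bs w) = wtSum w + ∑ t : Fin bs.length, (bs[(t : ℕ)] - 1) := by
  induction bs generalizing w with
  | nil =>
    obtain rfl : w = [] := List.length_eq_zero_iff.1 (by simpa using hw.symm)
    simp [wtSum, blockWord]
  | cons k bs ih =>
    rw [List.sum_cons] at hw
    have hw' : bs.sum = (w.drop k).length := by rw [List.length_drop]; omega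
    have h1 : ∑ t : Fin (k :: bs).length, ((k :: bs)[(t : ℕ)] - 1) =
        (k - 1) + ∑ t : Fin bs.length, (bs[(t : ℕ)] - 1) :=
      Fin.sum_univ_succ (n := bs.length) _
    have h2 : (w.take k).length = k := by rw [List.length_take]; omega
    rw [h1, blockWord, wtSum_cons, ih hw', hΨ, h2]
    conv_rhs => rw [← List.take_append_drop k w, wtSum_append]
    ring

end Blocks

/-! ### Tree operations as the composite of the outer operation with the coalgebra morphism -/

section NodeSum

variable {K : Type*} [Field K]
variable {A : Type*} [AddCommGroup A] [Module K A]
variable {H : Type*} [AddCommGroup H] [Module K H]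
variable {M : Type*} [AddCommGroup M] [Module K M]

theorem evalList_eq_fin (ν : ∀ k : ℕ, MultilinearMap K (fun _ : Fin k => A) M) {l : List A} {n : ℕ}
    (hl : l.length = n) (g : Fin n → A)
    (hg : ∀ q : Fin n, l[(q : ℕ)]'(by rw [hl]; exact q.2) = g q) : evalList ν l = ν n g := by
  subst hl
  exact congrArg _ (funext fun q : Fin l.length => hg q)

theorem susDeg_eq_sum {X : Type*} (u : List (Letter X)) {n : ℕ} (hu : u.length = n) :
    susDeg u = ∑ q : Fin n, (u[(q : ℕ)]'(by rw [hu]; exact q.2)).dg + n := by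
  subst hu
  have h1 : susDeg u = ∑ q : Fin u.length, (u[(q : ℕ)].dg + 1) := by
    rw [susDeg, ← Fin.sum_univ_fun_getElem]
  rw [h1, Finset.sum_add_distrib]
  simp

/-- Modulo 2, `i_t + 1` and `i_t - 1` agree. -/
theorem theta_sign {k : ℕ} (c : Composition k) :
    Int.negOnePow (theta c) = Int.negOnePow (∑ s : Fin c.length,
      (c.blocksFun s : ℤ) * ∑ t ∈ Finset.Ioi s, ((c.blocksFun t : ℤ) - 1)) := by
  rw [Int.negOnePow_eq_iff, theta]
  push_cast
  rw [← Finset.sum_sub_distrib]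
  refine Finset.even_sum _ fun s _ => ?_
  rw [Finset.mul_sum, ← Finset.sum_sub_distrib]
  refine Finset.even_sum _ fun t _ => ?_
  exact ⟨c.blocksFun s, by ring⟩

variable (𝒜 : ℤ → Submodule K A) [DirectSum.Decomposition 𝒜]
variable {μ φ : ∀ k : ℕ, MultilinearMap K (fun _ : Fin k => A) A} {α : A →ₗ[K] A}
  {ι : H →ₗ[K] A} {β : H →ₗ[K] H}

/-- Matches one composition with one summand of `nodeSum`. The sign `θ`, the Koszul signs and the
suspension signs of the blocks combine into the suspension sign of `w`. The power `∑_{t ≠ s} (i_t -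
1)` of `α` is the weight produced by the other blocks. -/
theorem wordOp_blockWord
    (hφ : ∀ k : ℕ, 1 ≤ k → ∀ x : Fin k → H, α (φ k fun j => ι (x j)) = φ k fun j => ι (β (x j)))
    {w : List (Letter H)} (hw : ∀ x ∈ w, ∀ n, ι ((β ^ n) x.val) ∈ 𝒜 x.dg)
    (c : Composition w.length) :
    wordOp μ α (blockWord (opLetter (wordOp (fun k => (φ k).compLinearMap fun _ => ι) β) 0)
        c.blocks w) =
      Int.negOnePow (susExp w) • Int.negOnePow (theta c) • plug c (μ c.length) (fun s =>
        (α ^ ∑ t ∈ Finset.univ.erase s, (c.blocksFun t - 1)).compMultilinearMap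
          ((φ (c.blocksFun s)).compLinearMap
            (fun _ => koszul 𝒜 ^ ∑ t ∈ Finset.Ioi s, (c.blocksFun t - 1))))
        (fun q => ι ((scaled β (wtSum w) w)[(q : ℕ)]'(by rw [length_scaled]; exact q.2))) := by
  set ψ : ∀ k : ℕ, MultilinearMap K (fun _ : Fin k => H) A :=
    fun k => (φ k).compLinearMap fun _ => ι with hψ_def
  set Ψ := opLetter (wordOp ψ β) 0 with hΨ
  have hψ : ∀ k : ℕ, 1 ≤ k → ∀ x : Fin k → H, α (ψ k x) = ψ k fun j => β (x j) := hφ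
  have hlen : ∀ s : Fin c.length, (wordBlock c.blocks w s).length = c.blocksFun s := fun s =>
    length_wordBlock c.blocks_sum s
  have hpos : ∀ s : Fin c.length, 1 ≤ c.blocksFun s := fun s => c.one_le_blocksFun s
  have hget : ∀ (s : Fin c.length) (j : Fin (c.blocksFun s)),
      (wordBlock c.blocks w s)[(j : ℕ)]'(by rw [hlen]; exact j.2) = w[(c.embedding s j : ℕ)] := by
    intro s j
    simp [wordBlock, Composition.sizeUpTo]
  -- the arguments of the outer operation, without signs
  set Z : Fin c.length → A := fun s => evalList ψ
    (scaled β (wtSum w + ∑ t ∈ Finset.univ.erase s, (c.blocksFun t - 1)) (wordBlock c.blocks w s))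
    with hZ
  have hsub : ∀ s, wtSum (wordBlock c.blocks w s) ≤ wtSum w := by
    intro s
    refine List.Sublist.sum_le_sum (List.Sublist.map _ ?_) fun _ _ => Nat.zero_le _
    exact (List.take_sublist _ _).trans (List.drop_sublist _ _)
  have h_left : wordOp μ α (blockWord Ψ c.blocks w) =
      Int.negOnePow (susExp (blockWord Ψ c.blocks w)) •
        μ c.length (fun s => Int.negOnePow (susExp (wordBlock c.blocks w s)) • Z s) := by
    rw [wordOp]
    congr 1
    refine evalList_eq_fin μ (by rw [length_scaled, length_blockWord]) _ fun s => ?_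
    simp only [scaled, List.getElem_map, getElem_blockWord]
    have h0 : wordBlock c.blocks w s ≠ [] := by
      intro h0
      have h1 := hlen s
      have h2 := hpos s
      rw [h0, List.length_nil] at h1
      omega
    rw [hΨ, opLetter, pow_wordOp hψ _ h0]
    simp only [hZ]
    congr 3
    rw [← hΨ, wtSum_blockWord (Ψ := Ψ) (fun u => rfl) c.blocks_sum, hlen]
    have h1 := Finset.add_sum_erase Finset.univ (fun t : Fin c.length => c.blocksFun t - 1)
      (Finset.mem_univ s)
    have h2 : ∑ t : Fin c.blocks.length, (c.blocks[(t : ℕ)] - 1) =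
      ∑ t : Fin c.length, (c.blocksFun t - 1) := rfl
    have h3 := hsub s
    omega
  have h_right : ∀ s : Fin c.length,
      (α ^ ∑ t ∈ Finset.univ.erase s, (c.blocksFun t - 1))
        (φ (c.blocksFun s) fun j => (koszul 𝒜 ^ ∑ t ∈ Finset.Ioi s, (c.blocksFun t - 1))
          (ι ((scaled β (wtSum w) w)[(c.embedding s j : ℕ)]'(by
            rw [length_scaled]; exact (c.embedding s j).2)))) =
        Int.negOnePow ((∑ t ∈ Finset.Ioi s, ((c.blocksFun t : ℤ) - 1)) *
          (susDeg (wordBlock c.blocks w s) - c.blocksFun s)) • Z s := by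
    intro s
    have h1 : ∀ j : Fin (c.blocksFun s),
        (koszul 𝒜 ^ ∑ t ∈ Finset.Ioi s, (c.blocksFun t - 1))
          (ι ((scaled β (wtSum w) w)[(c.embedding s j : ℕ)]'(by
            rw [length_scaled]; exact (c.embedding s j).2))) =
        Int.negOnePow ((∑ t ∈ Finset.Ioi s, ((c.blocksFun t : ℤ) - 1)) *
          w[(c.embedding s j : ℕ)].dg) •
          ι ((scaled β (wtSum w) w)[(c.embedding s j : ℕ)]'(by
            rw [length_scaled]; exact (c.embedding s j).2)) := by
      intro j
      rw [koszul_pow_of_mem 𝒜 (n := w[(c.embedding s j : ℕ)].dg)]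
      · congr 3
        push_cast
        refine Finset.sum_congr rfl fun t _ => ?_
        rw [Nat.cast_sub (hpos t), Nat.cast_one]
      · simp only [scaled, List.getElem_map]
        exact hw _ (List.getElem_mem _) _
    simp only [h1, map_units_smul_univ]
    rw [← negOnePow_sum, ← Finset.mul_sum, susDeg_eq_sum _ (hlen s), add_sub_cancel_right,
      Units.smul_def, map_zsmul, ← Units.smul_def]
    simp only [hget]
    congr 1
    refine (pow_comm_multi hψ _ _ (hpos s) _).trans ?_
    refine (evalList_eq_fin ψ (by rw [length_scaled, hlen]) _ fun j => ?_).symm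
    simp only [scaled, List.getElem_map, hget, pow_apply_pow_apply]
    have := wt_le_wtSum (List.getElem_mem (c.embedding s j).2)
    congr 2
    omega
  rw [h_left, plug_apply]
  simp only [LinearMap.compMultilinearMap_apply, MultilinearMap.compLinearMap_apply,
    Function.comp_apply, h_right, map_units_smul_univ, ← negOnePow_sum, ← mul_smul]
  congr 1
  rw [theta_sign, ← Int.negOnePow_add, ← Int.negOnePow_add, ← Int.negOnePow_add,
    susExp_blockWord (Ψ := Ψ) (fun u => by simp [hΨ, opLetter]) c.blocks_sum]
  rw [Int.negOnePow_eq_iff]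
  have h1 : ∀ T D b : Fin c.length → ℤ,
      ∑ s, T s * (D s - b s) = ∑ s, D s * T s - ∑ s, b s * T s := by
    intro T D b
    rw [← Finset.sum_sub_distrib]
    exact Finset.sum_congr rfl fun s _ => by ring
  rw [h1 (fun s => ∑ t ∈ Finset.Ioi s, ((c.blocksFun t : ℤ) - 1)) (fun s =>
    susDeg (wordBlock c.blocks w s)), Finset.sum_add_distrib]
  -- Again half the difference of the exponents.
  refine ⟨-∑ s : Fin c.length, susDeg (wordBlock c.blocks w s) *
    ∑ t ∈ Finset.Ioi s, ((c.blocksFun t : ℤ) - 1), ?_⟩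
  simp only [Composition.blocksFun, List.get_eq_getElem]
  ring

end NodeSum

section TreeOp

variable {K : Type*} [Field K]
variable {A : Type*} [AddCommGroup A] [Module K A]
variable {H : Type*} [AddCommGroup H] [Module K H]
variable (𝒜 : ℤ → Submodule K A) [DirectSum.Decomposition 𝒜]
variable {μ φ : ∀ k : ℕ, MultilinearMap K (fun _ : Fin k => A) A} {α : A →ₗ[K] A}
  {ι : H →ₗ[K] A} {β : H →ₗ[K] H}

theorem nodeSum_apply (k : ℕ) (a : Fin k → A) :
    nodeSum 𝒜 μ α φ k a = ∑ c : Composition k with 2 ≤ c.length,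
      Int.negOnePow (theta c) • plug c (μ c.length) (fun s =>
      (α ^ ∑ t ∈ Finset.univ.erase s, (c.blocksFun t - 1)).compMultilinearMap
        ((φ (c.blocksFun s)).compLinearMap
          (fun _ => koszul 𝒜 ^ ∑ t ∈ Finset.Ioi s, (c.blocksFun t - 1)))) a := by
  rw [nodeSum, sum_apply]
  rfl

theorem nodeSum_of_le_one {k : ℕ} (hk : k ≤ 1) : nodeSum 𝒜 μ α φ k = 0 := by
  rw [nodeSum]
  refine Finset.sum_eq_zero fun c hc => ?_
  have h1 := (Finset.mem_filter.1 hc).2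
  have h2 := c.length_le
  omega

/-- Compositions with at least two blocks add up to `nodeSum`; the single-block composition gives
the term with `μ 1`. -/
theorem wordLift_comorphism
    (hφ : ∀ k : ℕ, 1 ≤ k → ∀ x : Fin k → H, α (φ k fun j => ι (x j)) = φ k fun j => ι (β (x j)))
    {w : List (Letter H)} (hw : ∀ x ∈ w, ∀ n, ι ((β ^ n) x.val) ∈ 𝒜 x.dg) (hne : w ≠ []) :
    wordLift (wordOp μ α)
        (comorphism (opLetter (wordOp (fun k => (φ k).compLinearMap fun _ => ι) β) 0) w) =
      wordOp (fun k => (nodeSum 𝒜 μ α φ k).compLinearMap fun _ => ι) β w +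
        wordOp μ α [opLetter (wordOp (fun k => (φ k).compLinearMap fun _ => ι) β) 0 w] := by
  have hpos := List.length_pos_of_ne_nil hne
  rw [comorphism, map_sum]
  simp only [wordLift_word]
  rw [← Finset.sum_filter_add_sum_filter_not _ (fun c : Composition w.length => 2 ≤ c.length)]
  congr 1
  · rw [wordOp, evalList_eq_fin _ (length_scaled _ _ _) _ fun q => rfl,
      MultilinearMap.compLinearMap_apply, nodeSum_apply, Finset.smul_sum]
    exact Finset.sum_congr rfl fun c _ => wordOp_blockWord 𝒜 hφ hw c
  · have h1 : Finset.univ.filter (fun c : Composition w.length => ¬ 2 ≤ c.length) =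
        {Composition.single w.length hpos} := by
      ext c
      have := c.length_pos_of_pos hpos
      rw [Finset.mem_singleton, Composition.eq_single_iff_length]
      simp only [Finset.mem_filter, Finset.mem_univ, true_and]
      omega
    rw [h1, Finset.sum_singleton, Composition.single_blocks, blockWord, blockWord, List.take_length]

theorem nodeSum_comm (hα : IsLinOfDegree 𝒜 𝒜 α 0)
    (hμ : ∀ k : ℕ, 1 ≤ k → ∀ a : Fin k → A, α (μ k a) = μ k fun j => α (a j)) {k : ℕ}
    (hφ : ∀ m < k, ∀ a : Fin m → A, α (φ m a) = φ m fun j => α (a j)) (a : Fin k → A) :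
    α (nodeSum 𝒜 μ α φ k a) = nodeSum 𝒜 μ α φ k fun j => α (a j) := by
  simp only [nodeSum_apply, map_sum, Units.smul_def, map_zsmul]
  refine Finset.sum_congr rfl fun c hc => ?_
  have hc' : 2 ≤ c.length := (Finset.mem_filter.1 hc).2
  congr 1
  simp only [plug_apply, LinearMap.compMultilinearMap_apply, MultilinearMap.compLinearMap_apply,
    Function.comp_apply]
  rw [hμ _ (by omega)]
  congr 1
  funext s
  rw [← Module.End.mul_apply, ← pow_succ', pow_succ, Module.End.mul_apply,
    hφ _ (blocksFun_lt_of_two_le_length c hc' s)]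
  simp only [koszul_pow_comm 𝒜 hα]

/-- Degree count: `∑ (i_s - 1) + (l - 2) = k - 2`. Only `φ m` with `m < k` occurs, which is what the
recursion for `branch` can supply. -/
theorem nodeSum_degree (hα : IsLinOfDegree 𝒜 𝒜 α 0)
    (hμ : ∀ k : ℕ, 1 ≤ k → IsMultiOfDegree 𝒜 (μ k) ((k : ℤ) - 2)) {k : ℕ}
    (hφ : ∀ m, 1 ≤ m → m < k → IsMultiOfDegree 𝒜 (φ m) ((m : ℤ) - 1)) :
    IsMultiOfDegree 𝒜 (nodeSum 𝒜 μ α φ k) ((k : ℤ) - 2) := by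
  intro d a ha
  rw [nodeSum_apply]
  refine Submodule.sum_mem _ fun c hc => ?_
  have hc' : 2 ≤ c.length := (Finset.mem_filter.1 hc).2
  rw [Units.smul_def]
  refine zsmul_mem ?_ _
  have h1 := hμ c.length (by omega)
    (fun s => ∑ j, d (c.embedding s j) + ((c.blocksFun s : ℤ) - 1))
    (fun s => (α ^ ∑ t ∈ Finset.univ.erase s, (c.blocksFun t - 1)) (φ (c.blocksFun s) fun j =>
      (koszul 𝒜 ^ ∑ t ∈ Finset.Ioi s, (c.blocksFun t - 1)) (a (c.embedding s j))))
    fun s => pow_mem_of_degree_zero 𝒜 hα (hφ _ (c.one_le_blocksFun s)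
      (blocksFun_lt_of_two_le_length c hc' s) _ _ fun j => koszul_pow_mem 𝒜 (ha _) _) _
  have h2 : ∑ s, ∑ j, d (c.embedding s j) = ∑ q, d q := by
    rw [← c.blocksFinEquiv.sum_comp, Fintype.sum_sigma]
    rfl
  have h3 : ∑ s, (c.blocksFun s : ℤ) = k := by
    rw [← Nat.cast_sum, c.sum_blocksFun]
  rw [Finset.sum_add_distrib, Finset.sum_sub_distrib, h2, h3] at h1
  have h4 : ∑ q, d q + ((k : ℤ) - ∑ _s : Fin c.length, 1) + ((c.length : ℤ) - 2) =
      ∑ q, d q + ((k : ℤ) - 2) := by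
    simp
    ring
  rw [h4] at h1
  exact h1

variable {h : A →ₗ[K] A}

theorem branch_comm (hα : IsLinOfDegree 𝒜 𝒜 α 0)
    (hμ : ∀ k : ℕ, 1 ≤ k → ∀ a : Fin k → A, α (μ k a) = μ k fun j => α (a j))
    (hh : ∀ a, α (h a) = h (α a)) (k : ℕ) (a : Fin k → A) :
    α (branch 𝒜 μ α h k a) = branch 𝒜 μ α h k fun j => α (a j) := by
  induction k using Nat.strong_induction_on with
  | _ k ih =>
    rcases Nat.lt_or_ge k 2 with hk | hk
    · interval_cases k
      · simp [branch]
      · rw [branch_one, branch_one]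
    · rw [branch_of_two_le 𝒜 μ α h hk]
      simp only [LinearMap.compMultilinearMap_apply, LinearMap.neg_apply, map_neg, hh, treeOp]
      rw [nodeSum_comm 𝒜 hα hμ ih]

theorem branch_degree (hα : IsLinOfDegree 𝒜 𝒜 α 0)
    (hμ : ∀ k : ℕ, 1 ≤ k → IsMultiOfDegree 𝒜 (μ k) ((k : ℤ) - 2))
    (hh : IsLinOfDegree 𝒜 𝒜 h 1) (k : ℕ) (hk : 1 ≤ k) :
    IsMultiOfDegree 𝒜 (branch 𝒜 μ α h k) ((k : ℤ) - 1) := by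
  induction k using Nat.strong_induction_on with
  | _ k ih =>
    rcases Nat.lt_or_ge k 2 with hk' | hk'
    · obtain rfl : k = 1 := by omega
      intro d a ha
      rw [branch_one]
      simpa using ha 0
    · rw [branch_of_two_le 𝒜 μ α h hk']
      intro d a ha
      have h1 := hh _ _ (nodeSum_degree 𝒜 hα hμ (fun m hm hmk => ih m hmk hm) d a ha)
      rw [show (∑ j, d j + ((k : ℤ) - 1)) = ∑ j, d j + ((k : ℤ) - 2) + 1 by ring]
      exact neg_mem h1

end TreeOp

/-! ### The inductive step: comparing the two coderivations along the coalgebra morphism -/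

section Words

variable {X M : Type*}

theorem splitSum_eq_nil [AddCommMonoid M] {F : List X → List X → M} {w : List X}
    (hF : ∀ u v, u ++ v = w → u ≠ [] → F u v = 0) : splitSum F w = F [] w := by
  cases w with
  | nil => rfl
  | cons x w =>
    rw [splitSum, splitSum_congr w (G := fun _ _ => 0) fun u v huv =>
      hF (x :: u) v (by simp [huv]) (by simp), splitSum_zero, add_zero]

theorem splitSum_eq_full [AddCommMonoid M] {F : List X → List X → M} {w : List X}
    (hF : ∀ u v, u ++ v = w → v ≠ [] → F u v = 0) : splitSum F w = F w [] := by
  induction w generalizing F with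
  | nil => rfl
  | cons x w ih =>
    rw [splitSum, hF [] _ rfl (by simp), zero_add,
      ih fun u v huv hv => hF (x :: u) v (by simp [huv]) hv]

theorem splitSum_mem [AddCommGroup M] (S : AddSubgroup M) {F : List X → List X → M} {w : List X}
    (hF : ∀ u v, u ++ v = w → F u v ∈ S) : splitSum F w ∈ S := by
  rw [splitSum_eq_sum]
  exact S.sum_mem fun n _ => hF _ _ (List.take_append_drop n w)

theorem wordDer_mem [AddCommGroup M] (S : AddSubgroup M) {b : List X → X} {sg : List X → ℤˣ}
    {f : List X → M} {w : List X}
    (hf : ∀ u m v, u ++ (m ++ v) = w → m ≠ [] → f (u ++ b m :: v) ∈ S) :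
    wordDer b sg f w ∈ S := by
  refine splitSum_mem S fun u y huy => splitSum_mem S fun m v hmv => ?_
  split_ifs with hm
  · exact S.zero_mem
  · rw [Units.smul_def]
    exact S.zsmul_mem (hf u m v (by rw [hmv, huy]) hm) _

theorem wordDer_congr [AddCommGroup M] {b : List X → X} {sg : List X → ℤˣ} {f g : List X → M}
    {w : List X}
    (hfg : ∀ u m v, u ++ (m ++ v) = w → m ≠ [] → f (u ++ b m :: v) = g (u ++ b m :: v)) :
    wordDer b sg f w = wordDer b sg g w := by
  refine splitSum_congr w fun u y huy => splitSum_congr y fun m v hmv => ?_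
  split_ifs with hm
  · rfl
  · rw [hfg u m v (by rw [hmv, huy]) hm]

/-- A function on letters, extended by zero to all words. -/
def onLetter [Zero M] (f : X → M) : List X → M
  | [x] => f x
  | _ => 0

theorem onLetter_eq_zero [Zero M] (f : X → M) {l : List X} (hl : l.length ≠ 1) :
    onLetter f l = 0 := by
  rcases l with _ | ⟨x, _ | ⟨y, l⟩⟩
  · rfl
  · simp at hl
  · rfl

/-- Only contracting the whole word leaves a single letter. -/
theorem wordDer_onLetter [AddCommGroup M] (b : List X → X) {sg : List X → ℤˣ} (hsg : sg [] = 1)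
    (f : X → M) {w : List X} (hw : w ≠ []) : wordDer b sg (onLetter f) w = f (b w) := by
  rw [wordDer, splitSum_eq_nil, splitSum_eq_full, if_neg hw, hsg, one_smul]
  · rfl
  · intro m v _ hv
    rw [onLetter_eq_zero, smul_zero, ite_self]
    simpa using hv
  · intro u y _ hu
    have h1 : ∀ (z : X) v, onLetter f (u ++ z :: v) = 0 := fun z v => by
      apply onLetter_eq_zero
      have := List.length_pos_of_ne_nil hu
      simp only [List.length_append, List.length_cons]
      omega
    simp only [h1, smul_zero, ite_self, splitSum_zero]

theorem wordLift_comorphism_congr {L : Type*} [AddCommGroup M] (Ψ : List X → L) {f g : List L → M}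
    (hfg : ∀ a l, f (a :: l) = g (a :: l)) {w : List X} (hw : w ≠ []) :
    wordLift f (comorphism Ψ w) = wordLift g (comorphism Ψ w) := by
  cases w with
  | nil => exact absurd rfl hw
  | cons x w => simp only [wordLift_comorphism_cons, hfg]

end Words

theorem susDeg_blockWord {X A : Type*} {Ψ : List (Letter X) → Letter A}
    (hΨ : ∀ u, (Ψ u).dg = susDeg u - 1) {bs : List ℕ} {w : List (Letter X)}
    (hw : bs.sum = w.length) : susDeg (blockWord Ψ bs w) = susDeg w := by
  induction bs generalizing w with
  | nil =>
    obtain rfl : w = [] := List.length_eq_zero_iff.1 (by simpa using hw.symm)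
    rfl
  | cons k bs ih =>
    rw [List.sum_cons] at hw
    rw [blockWord, susDeg_cons, hΨ, ih (by rw [List.length_drop]; omega)]
    conv_rhs => rw [← List.take_append_drop k w, susDeg_append]
    ring

section MainStep

variable {K : Type*} [Field K]
variable {A : Type*} [AddCommGroup A] [Module K A]
variable {H : Type*}
variable (μ : ∀ k : ℕ, MultilinearMap K (fun _ : Fin k => A) A) (α : A →ₗ[K] A)

/-- The sum of the values of the letters in a formal sum of letters. -/
def letterVal : FreeWords (Letter A) →+ A := wordLift (onLetter Letter.val)

/-- Formal sums of letters of a fixed weight and degree. -/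
def letterSums (A : Type*) (k : ℕ) (e : ℤ) : AddSubgroup (FreeWords (Letter A)) :=
  AddSubgroup.closure (Set.range fun a : A => word [⟨a, k, e⟩])

/-- The sign and the scaling in `wordOp` depend on weights and degrees, so additivity in a letter is
available only when these are fixed. Then a formal sum of letters may be replaced by the letter with
the summed value. -/
theorem wordLift_mul_letterSums {k : ℕ} {e : ℤ} {z : FreeWords (Letter A)}
    (hz : z ∈ letterSums A k e) (u v : List (Letter A)) :
    wordLift (wordOp μ α) (word u * (z * word v)) = wordOpHom μ α u v k e (letterVal z) := by
  induction hz using AddSubgroup.closure_induction with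
  | mem z hz =>
    obtain ⟨a, rfl⟩ := hz
    simp only [letterVal, wordLift_word, wordOpHom_apply, onLetter, ← word_append]
    rfl
  | zero => simp
  | add x y _ _ hx hy => simp only [add_mul, mul_add, map_add, hx, hy]
  | neg x _ hx => simp only [neg_mul, mul_neg, map_neg, hx]

/-- Letters whose values cancel do not cancel as formal words; under `wordOp` they nevertheless
contribute zero. -/
theorem wordLift_mul_eq_zero {k : ℕ} {e : ℤ} {z : FreeWords (Letter A)}
    (hz : z ∈ letterSums A k e) (hz0 : letterVal z = 0) (x y : FreeWords (Letter A)) :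
    wordLift (wordOp μ α) (x * (z * y)) = 0 := by
  have h1 : ∀ v, (wordLift (wordOp μ α)).comp (AddMonoidHom.mulRight (z * word v)) = 0 := fun v =>
    freeWords_hom_ext fun u => by
      simpa [hz0] using wordLift_mul_letterSums μ α hz u v
  have h2 : ((wordLift (wordOp μ α)).comp (AddMonoidHom.mulLeft x)).comp (AddMonoidHom.mulLeft z) =
      0 := freeWords_hom_ext fun v => by simpa using DFunLike.congr_fun (h1 v) x
  simpa using DFunLike.congr_fun h2 y

variable {ψ : List (Letter H) → A} {bH : List (Letter H) → H}

omit [AddCommGroup A] in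
-- All terms share one weight, since contracting `m` trades `m.length - 1` letters for the same
-- amount of weight. In the degree, one unit is lost to the degree `-1` operation and one to
-- desuspension.
theorem wordDer_letterWord_mem (w : List (Letter H)) :
    wordDer (opLetter bH (-1)) wordSign (letterWord (opLetter ψ 0)) w ∈
      letterSums A (wtSum w + (w.length - 1)) (susDeg w - 2) := by
  refine wordDer_mem _ fun u m v hw hm => ?_
  rw [letterWord, if_neg (by simp)]
  refine AddSubgroup.subset_closure ⟨ψ (u ++ opLetter bH (-1) m :: v), ?_⟩
  have := List.length_pos_of_ne_nil hm
  simp only [← hw, opLetter, wtSum_append, wtSum_cons, susDeg_append, susDeg_cons,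
    List.length_append, List.length_cons]
  congr 3
  · omega
  · ring

theorem wordLift_letterWord_mem {w : List (Letter H)} (hw : w ≠ []) :
    wordLift (letterWord (opLetter (wordOp μ α) (-1))) (comorphism (opLetter ψ 0) w) ∈
      letterSums A (wtSum w + (w.length - 1)) (susDeg w - 2) := by
  rw [comorphism, map_sum]
  refine AddSubgroup.sum_mem _ fun c _ => ?_
  have h_len := c.length_pos_of_pos (List.length_pos_of_ne_nil hw)
  rw [wordLift_word, letterWord, if_neg]
  · refine AddSubgroup.subset_closure
      ⟨wordOp μ α (blockWord (opLetter ψ 0) c.blocks w), ?_⟩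
    have h1 : ∑ t : Fin c.blocks.length, (c.blocks[(t : ℕ)] - 1) + c.blocks.length = w.length := by
      have h2 : ∑ t : Fin c.length, (c.blocksFun t - 1 + 1) = ∑ t : Fin c.length, c.blocksFun t :=
        Finset.sum_congr rfl fun t _ => Nat.sub_add_cancel (c.one_le_blocksFun t)
      rw [c.sum_blocksFun, Finset.sum_add_distrib, Fin.sum_const, smul_eq_mul, mul_one] at h2
      exact h2
    simp only
    rw [opLetter, wtSum_blockWord (fun u => rfl) c.blocks_sum, length_blockWord,
      susDeg_blockWord (fun u => by simp [opLetter]) c.blocks_sum]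
    have h3 : wtSum w + ∑ t : Fin c.blocks.length, (c.blocks[(t : ℕ)] - 1) +
        (c.blocks.length - 1) = wtSum w + (w.length - 1) := by
      have : 0 < c.blocks.length := h_len
      omega
    rw [h3]
    congr 3
    ring
  · intro h0
    have := congrArg List.length h0
    rw [length_blockWord] at this
    exact h_len.ne' this

theorem wordSign_nil {A : Type*} : wordSign ([] : List (Letter A)) = 1 := by
  simp [wordSign, susDeg]

theorem wordDer_word (l : List (Letter A)) :
    conv (signed wordSign word) (conv (letterWord (opLetter (wordOp μ α) (-1))) word) l =
      wordDer (opLetter (wordOp μ α) (-1)) wordSign word l := by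
  rw [conv, wordDer]
  refine splitSum_congr l fun u y _ => ?_
  rw [conv, mul_splitSum]
  refine splitSum_congr y fun m v _ => ?_
  rw [letterWord, signed]
  split_ifs
  · simp
  · rw [smul_mul_assoc, ← word_append, ← word_append]
    rfl

/-- With `δ` the letter part of `F D_H` and `γ` that of `D_A F`, the two maps are `F^± * δ * F` and
`F^± * γ * F`. The second is killed by the outer operation. By `hE` the values of `δ - γ` vanish on
proper nonempty subwords, so the difference reduces to the full word, where the outer operation is
`μ 1`. -/
theorem wordDer_wordLift_comorphism {Q : Letter H → Prop} {P : Letter A → Prop}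
    (hΨ : ∀ u, u ≠ [] → (∀ x ∈ u, Q x) → P (opLetter ψ 0 u))
    (hA : ∀ l, (∀ a ∈ l, P a) →
      wordDer (opLetter (wordOp μ α) (-1)) wordSign (wordOp μ α) l = 0)
    {w : List (Letter H)} (hw : ∀ x ∈ w, Q x) (hne : w ≠ [])
    (hE : ∀ m, m ≠ [] → m.length < w.length → (∀ x ∈ m, Q x) →
      wordLift (wordOp μ α) (comorphism (opLetter ψ 0) m) =
        wordDer (opLetter bH (-1)) wordSign ψ m) :
    wordDer (opLetter bH (-1)) wordSign
        (fun u => wordLift (wordOp μ α) (comorphism (opLetter ψ 0) u)) w =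
      μ 1 fun _ => wordDer (opLetter bH (-1)) wordSign ψ w -
        wordLift (wordOp μ α) (comorphism (opLetter ψ 0) w) := by
  set Ψ := opLetter ψ 0 with hΨ_def
  set δ : List (Letter H) → FreeWords (Letter A) :=
    wordDer (opLetter bH (-1)) wordSign (letterWord Ψ) with hδ
  set γ : List (Letter H) → FreeWords (Letter A) := fun u =>
    wordLift (letterWord (opLetter (wordOp μ α) (-1))) (comorphism Ψ u) with hγ
  -- `F` preserves the suspended degree, so the sign may be read off before or after applying it.
  have h_sign : (fun u => wordLift (signed wordSign word) (comorphism Ψ u)) =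
      signed wordSign (comorphism Ψ) := by
    funext u
    rw [signed, comorphism, map_sum, Finset.smul_sum]
    refine Finset.sum_congr rfl fun c _ => ?_
    rw [wordLift_word, signed, wordSign, wordSign,
      susDeg_blockWord (fun u => by simp [hΨ_def, opLetter]) c.blocks_sum]
  have h_word : ∀ u, wordLift word (comorphism Ψ u) = comorphism Ψ u := by
    intro u
    have : wordLift (word : List (Letter A) → _) = AddMonoidHom.id _ :=
      freeWords_hom_ext fun l => by simp [wordLift_word]
    rw [this, AddMonoidHom.id_apply]
  -- This is `b_A D_A F = 0`; `F` sends homogeneous words to sums of homogeneous words, on which the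
  -- identity `hA` is available.
  have h_zero : wordLift (wordOp μ α) (conv (signed wordSign (comorphism Ψ))
      (conv γ (comorphism Ψ)) w) = 0 := by
    have h1 : conv (signed wordSign (comorphism Ψ)) (conv γ (comorphism Ψ)) w =
        wordLift (wordDer (opLetter (wordOp μ α) (-1)) wordSign word) (comorphism Ψ w) := by
      rw [← funext (wordDer_word μ α), wordLift_conv_comorphism, h_sign]
      congr 1
      funext u
      rw [wordLift_conv_comorphism]
      simp only [h_word, hγ]
    rw [h1, ← wordLift_comp]
    refine wordLift_comorphism_eq_zero Ψ hΨ (fun l hl => ?_) hw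
    rw [map_wordDer]
    simp only [wordLift_word]
    exact hA l hl
  have h_val : ∀ m, m ≠ [] → letterVal (δ m - γ m) = wordDer (opLetter bH (-1)) wordSign ψ m -
      wordLift (wordOp μ α) (comorphism Ψ m) := by
    intro m hm
    rw [map_sub, hδ, map_wordDer, hγ]
    congr 1
    · refine wordDer_congr fun u m v _ _ => ?_
      rw [letterWord, if_neg (by simp), letterVal, wordLift_word]
      rfl
    · simp only
      rw [← wordLift_comp]
      refine wordLift_comorphism_congr Ψ (fun a l => ?_) hm
      rw [letterWord, if_neg (by simp), letterVal, wordLift_word]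
      rfl
  have h_mem : ∀ m, m ≠ [] → δ m - γ m ∈ letterSums A (wtSum m + (m.length - 1)) (susDeg m - 2) :=
    fun m hm => sub_mem (wordDer_letterWord_mem m) (wordLift_letterWord_mem μ α hm)
  have h_term : ∀ u m v, u ++ (m ++ v) = w → (u ≠ [] ∨ v ≠ []) → ∀ x y : FreeWords (Letter A),
      wordLift (wordOp μ α) (x * ((δ m - γ m) * y)) = 0 := by
    intro u m v huv hne' x y
    by_cases hm : m = []
    · subst hm
      have h1 : δ [] = 0 := by simp [hδ, wordDer, splitSum]
      have h2 : γ [] = 0 := by simp [hγ, wordLift_comorphism_nil, letterWord]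
      rw [h1, h2, sub_zero, zero_mul, mul_zero, map_zero]
    · refine wordLift_mul_eq_zero μ α (h_mem m hm) ?_ x y
      rw [h_val m hm, hE m hm, sub_self]
      · rw [← huv]
        simp only [List.length_append]
        rcases hne' with h | h
        · have := List.length_pos_of_ne_nil h
          omega
        · have := List.length_pos_of_ne_nil h
          omega
      · intro x hx
        exact hw x (by rw [← huv]; simp [hx])
  have h_diff : conv (signed wordSign (comorphism Ψ)) (conv δ (comorphism Ψ)) =
      conv (signed wordSign (comorphism Ψ)) (conv γ (comorphism Ψ)) +
      conv (signed wordSign (comorphism Ψ)) (conv (δ - γ) (comorphism Ψ)) := by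
    rw [← conv_add, ← add_conv, add_sub_cancel]
  rw [← map_wordDer (opLetter bH (-1)) wordSign (wordLift (wordOp μ α)) (comorphism Ψ),
    wordDer_comorphism Ψ _ wordSign_append, ← hδ, h_diff, Pi.add_apply, map_add, h_zero, zero_add,
    conv, map_splitSum, splitSum_eq_nil, conv, mul_splitSum, map_splitSum, splitSum_eq_full]
  · have h1 := wordLift_mul_letterSums μ α (h_mem w hne) [] []
    rw [signed, wordSign_nil, one_smul, comorphism_nil, Pi.sub_apply]
    rw [word_nil] at h1
    rw [h1, h_val w hne, wordOpHom_apply]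
    rw [wordOp]
    simp only [List.nil_append]
    rw [evalList_eq μ (n := 1) (by simp [scaled]) (fun _ => wordDer (opLetter bH (-1)) wordSign ψ w -
        wordLift (wordOp μ α) (comorphism Ψ w))]
    · simp [susExp]
    · intro q hq
      simp [scaled, wtSum]
  · intro m v hmv hv
    exact h_term [] m v (by simpa using hmv) (Or.inr hv) _ _
  · intro u y huy hu
    rw [conv, mul_splitSum, map_splitSum, splitSum_congr y (G := fun _ _ => 0), splitSum_zero]
    intro m v hmv
    exact h_term u m v (by rw [hmv, huy]) (Or.inl hu) _ _

end MainStep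

/-! ### The transferred structure and its identities -/

section Transferred

variable {K : Type*} [Field K]
variable {A : Type*} [AddCommGroup A] [Module K A]
variable {H : Type*} [AddCommGroup H] [Module K H]

theorem wordOp_singleton {M : Type*} [AddCommGroup M] [Module K M]
    (ν : ∀ k : ℕ, MultilinearMap K (fun _ : Fin k => H) M) (β : H →ₗ[K] H) (x : Letter H) :
    wordOp ν β [x] = ν 1 fun _ => x.val := by
  rw [wordOp, evalList_eq ν (n := 1) (by simp [scaled]) fun _ => x.val]
  · simp [susExp]
  · intro q hq
    simp [scaled, wtSum]

theorem wordOp_mem {M : Type*} [AddCommGroup M] [Module K M] {ℋ : ℤ → Submodule K H}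
    {ℳ : ℤ → Submodule K M} {ν : ∀ k : ℕ, MultilinearMap K (fun _ : Fin k => H) M} {β : H →ₗ[K] H}
    {e : ℤ} (hβ : IsLinOfDegree ℋ ℋ β 0)
    (hν : ∀ k : ℕ, 1 ≤ k → ∀ (d : Fin k → ℤ) (a : Fin k → H), (∀ j, a j ∈ ℋ (d j)) →
      ν k a ∈ ℳ ((∑ j, d j) + (k + e)))
    {w : List (Letter H)} (hw : ∀ x ∈ w, x.val ∈ ℋ x.dg) (hne : w ≠ []) :
    wordOp ν β w ∈ ℳ (susDeg w + e) := by
  rw [wordOp, Units.smul_def, evalList_eq_fin ν (length_scaled _ _ _) _ fun q => rfl]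
  refine zsmul_mem ?_ _
  have h1 := hν w.length (List.length_pos_of_ne_nil hne) (fun q => w[(q : ℕ)].dg)
    (fun q => (scaled β (wtSum w) w)[(q : ℕ)]'(by rw [length_scaled]; exact q.2)) fun q => by
      simp only [scaled, List.getElem_map]
      exact pow_mem_of_degree_zero ℋ hβ (hw _ (List.getElem_mem _)) _
  rwa [← add_assoc, ← susDeg_eq_sum w rfl] at h1

variable (𝒜 : ℤ → Submodule K A) [DirectSum.Decomposition 𝒜]
variable {μ : ∀ k : ℕ, MultilinearMap K (fun _ : Fin k => A) A} {α h : A →ₗ[K] A}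
  {p : A →ₗ[K] H} {i : H →ₗ[K] A} {dH : H →ₗ[K] H}

theorem treeOp_one : treeOp 𝒜 μ α h 1 = 0 := nodeSum_of_le_one 𝒜 le_rfl

theorem transferredOp_one (x : Fin 1 → H) : transferredOp 𝒜 μ α dH p i h 1 x = dH (x 0) := rfl

theorem transferredOp_of_two_le {k : ℕ} (hk : 2 ≤ k) :
    transferredOp 𝒜 μ α dH p i h k =
      p.compMultilinearMap ((treeOp 𝒜 μ α h k).compLinearMap fun _ => i) := by
  obtain ⟨k, rfl⟩ := Nat.exists_eq_add_of_le' hk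
  rfl

variable (μ α h i) in
/-- The operation on words induced by the maps `μ_k^A ∘ i^{⊗ k}`. -/
noncomputable def treeWordOp (β : H →ₗ[K] H) : List (Letter H) → A :=
  wordOp (fun k => (treeOp 𝒜 μ α h k).compLinearMap fun _ => i) β

variable (μ α h i) in
/-- The operation on words induced by the maps `φ_k ∘ i^{⊗ k}`. -/
noncomputable def branchWordOp (β : H →ₗ[K] H) : List (Letter H) → A :=
  wordOp (fun k => (branch 𝒜 μ α h k).compLinearMap fun _ => i) β

variable (μ α dH p i h) in
/-- The operation on words induced by the transferred operations. -/
noncomputable def transferredWordOp (β : H →ₗ[K] H) : List (Letter H) → H :=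
  wordOp (transferredOp 𝒜 μ α dH p i h) β

variable {β : H →ₗ[K] H}

theorem treeWordOp_singleton (x : Letter H) : treeWordOp 𝒜 μ α h i β [x] = 0 := by
  rw [treeWordOp, wordOp_singleton, treeOp_one]
  rfl

theorem branchWordOp_eq {w : List (Letter H)} (hw : w ≠ []) :
    branchWordOp 𝒜 μ α h i β w =
      onLetter (fun x => i x.val) w - h (treeWordOp 𝒜 μ α h i β w) := by
  rcases w with _ | ⟨x, _ | ⟨y, w⟩⟩
  · exact absurd rfl hw
  · rw [treeWordOp_singleton, branchWordOp, wordOp_singleton, MultilinearMap.compLinearMap_apply,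
      branch_one, map_zero, sub_zero]
    rfl
  · rw [onLetter_eq_zero _ (by simp), zero_sub, branchWordOp, treeWordOp, wordOp, wordOp, evalList,
      evalList, branch_of_two_le _ _ _ _ (by simp [scaled]), Units.smul_def, Units.smul_def, map_zsmul,
      ← smul_neg]
    rfl

theorem transferredWordOp_eq {w : List (Letter H)} (hw : w ≠ []) :
    transferredWordOp 𝒜 μ α h p i dH β w =
      onLetter (fun x => dH x.val) w + p (treeWordOp 𝒜 μ α h i β w) := by
  rcases w with _ | ⟨x, _ | ⟨y, w⟩⟩
  · exact absurd rfl hw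
  · rw [treeWordOp_singleton, transferredWordOp, wordOp_singleton, transferredOp_one, map_zero,
      add_zero]
    rfl
  · rw [onLetter_eq_zero _ (by simp), zero_add, transferredWordOp, treeWordOp, wordOp, wordOp,
      evalList, evalList, transferredOp_of_two_le _ (by simp [scaled]), Units.smul_def, Units.smul_def,
      map_zsmul]
    rfl

variable {ℋ : ℤ → Submodule K H} {dA : A →ₗ[K] A}

omit [DirectSum.Decomposition 𝒜] in
-- `α` commutes with `dA = μ 1` and with `h`, hence with `1 - (dA h + h dA)`. Together with `p i =
-- 1` this gives `α ∘ i = i ∘ α_H`.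
theorem IsContraction.inclusion_projection_comm (hcontr : IsContraction 𝒜 ℋ dA dH p i h)
    (hμ : IsHAInfinity 𝒜 μ α) (hμ_one : ∀ a : A, μ 1 (fun _ => a) = dA a)
    (hα : ∀ a : A, α (h a) = h (α a)) (a : A) : α (i (p a)) = i (p (α a)) := by
  have h1 : ∀ a, α (dA a) = dA (α a) := fun a => by
    rw [← hμ_one, ← hμ_one]
    exact hμ.α_μ 1 le_rfl _
  have h2 : ∀ a, i (p a) = a - (dA (h a) + h (dA a)) := fun a => by
    rw [← hcontr.homotopy]
    abel
  rw [h2, h2, map_sub, map_add, h1, hα, hα, h1]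

theorem transferredOp_degree (hdH : IsChainComplex ℋ dH) (hcontr : IsContraction 𝒜 ℋ dA dH p i h)
    (hμ : IsHAInfinity 𝒜 μ α) (k : ℕ) (hk : 1 ≤ k) :
    IsMultiOfDegree ℋ (transferredOp 𝒜 μ α dH p i h k) ((k : ℤ) - 2) := by
  intro d a ha
  rcases Nat.lt_or_ge k 2 with hk' | hk'
  · obtain rfl : k = 1 := by omega
    rw [transferredOp_one]
    simpa using hdH.degree _ _ (ha 0)
  · rw [transferredOp_of_two_le 𝒜 hk']
    have h1 : treeOp 𝒜 μ α h k (fun j => i (a j)) ∈ 𝒜 (∑ j, d j + ((k : ℤ) - 2)) :=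
      nodeSum_degree 𝒜 hμ.degree_α hμ.degree_μ
        (fun m hm _ => branch_degree 𝒜 hμ.degree_α hμ.degree_μ hcontr.degree_h m hm) d _
        fun j => by simpa using hcontr.degree_i _ _ (ha j)
    simpa using hcontr.degree_p _ _ h1

theorem transferredOp_comm (hcontr : IsContraction 𝒜 ℋ dA dH p i h)
    (hμ : IsHAInfinity 𝒜 μ α) (hμ_one : ∀ a : A, μ 1 (fun _ => a) = dA a)
    (hα : ∀ a : A, α (h a) = h (α a)) (k : ℕ) (hk : 1 ≤ k) (a : Fin k → H) :
    (p ∘ₗ α ∘ₗ i) (transferredOp 𝒜 μ α dH p i h k a) =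
      transferredOp 𝒜 μ α dH p i h k fun j => (p ∘ₗ α ∘ₗ i) (a j) := by
  have hip := hcontr.inclusion_projection_comm 𝒜 hμ hμ_one hα
  simp only [LinearMap.comp_apply]
  rcases Nat.lt_or_ge k 2 with hk' | hk'
  · obtain rfl : k = 1 := by omega
    rw [transferredOp_one, transferredOp_one, hcontr.chain_i, ← hcontr.chain_p, ← hμ_one,
      hμ.α_μ 1 le_rfl, hμ_one]
  · rw [transferredOp_of_two_le 𝒜 hk']
    simp only [LinearMap.compMultilinearMap_apply, MultilinearMap.compLinearMap_apply, hip,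
      hcontr.retract]
    rw [treeOp, nodeSum_comm 𝒜 hμ.degree_α hμ.α_μ
      fun m _ => branch_comm 𝒜 hμ.degree_α hμ.α_μ hα m]
    congr 2
    funext j
    rw [← hip, hcontr.retract]

omit [DirectSum.Decomposition 𝒜] in
theorem wordDer_wordOp_eq_zero (hμ : IsHAInfinity 𝒜 μ α) (l : List (Letter A))
    (hl : ∀ a ∈ l, a.val ∈ 𝒜 a.dg) :
    wordDer (opLetter (wordOp μ α) (-1)) wordSign (wordOp μ α) l = 0 := by
  by_cases hne : l = []
  · subst hne
    simp [wordDer, splitSum]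
  -- Beyond the end of the word the sequences are padded with `0`, which is homogeneous of degree
  -- `0`.
  · rw [wordDer_wordOp hμ.α_μ l
      (a := fun q => if hq : q < l.length then (α ^ (wtSum l - l[q].wt)) l[q].val else 0)
      (d := fun q => if hq : q < l.length then l[q].dg else 0)
      (fun q hq => by rw [dif_pos hq]) (fun q hq => by rw [dif_pos hq]),
      hμ.identity _ (List.length_pos_of_ne_nil hne), smul_zero]
    intro q
    split_ifs with hq
    · exact pow_mem_of_degree_zero 𝒜 hμ.degree_α (hl _ (List.getElem_mem _)) _
    · exact zero_mem _

variable (hdA : IsChainComplex 𝒜 dA) (hdH : IsChainComplex ℋ dH) (hcontr : IsContraction 𝒜 ℋ dA dH p i h)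
  (hμ : IsHAInfinity 𝒜 μ α) (hμ_one : ∀ a : A, μ 1 (fun _ => a) = dA a)
  (hα : ∀ a : A, α (h a) = h (α a)) (hβ : β = p ∘ₗ α ∘ₗ i)

omit [DirectSum.Decomposition 𝒜] in
include hcontr hμ in
theorem IsContraction.degree_transferred : IsLinOfDegree ℋ ℋ (p ∘ₗ α ∘ₗ i) 0 := fun n a ha => by
  simpa using hcontr.degree_p _ _ (hμ.degree_α _ _ (hcontr.degree_i _ _ ha))

include hcontr hμ hμ_one hα hβ in
theorem wordLift_comorphism_branchWordOp {w : List (Letter H)} (hw : ∀ x ∈ w, x.val ∈ ℋ x.dg)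
    (hne : w ≠ []) :
    wordLift (wordOp μ α) (comorphism (opLetter (branchWordOp 𝒜 μ α h i β) 0) w) =
      treeWordOp 𝒜 μ α h i β w + dA (branchWordOp 𝒜 μ α h i β w) := by
  have hip := hcontr.inclusion_projection_comm 𝒜 hμ hμ_one hα
  rw [branchWordOp, wordLift_comorphism 𝒜 _ _ hne, wordOp_singleton, hμ_one]
  · rfl
  · intro k _ x
    rw [branch_comm 𝒜 hμ.degree_α hμ.α_μ hα]
    congr 1
    funext j
    simp only [hβ, LinearMap.comp_apply]
    rw [← hip, hcontr.retract]
  · intro x hx n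
    have h1 : (β ^ n) x.val ∈ ℋ x.dg := pow_mem_of_degree_zero ℋ
      (hβ ▸ hcontr.degree_transferred 𝒜 hμ) (hw x hx) n
    simpa using hcontr.degree_i _ _ h1

include hdH hcontr hμ hβ in
theorem opLetter_transferredWordOp_mem {m : List (Letter H)} (hm : ∀ x ∈ m, x.val ∈ ℋ x.dg)
    (hne : m ≠ []) : (opLetter (transferredWordOp 𝒜 μ α h p i dH β) (-1) m).val ∈
      ℋ (opLetter (transferredWordOp 𝒜 μ α h p i dH β) (-1) m).dg := by
  have h1 : transferredWordOp 𝒜 μ α h p i dH β m ∈ ℋ (susDeg m + -2) :=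
    wordOp_mem (ℳ := ℋ) (hβ ▸ hcontr.degree_transferred 𝒜 hμ)
      (fun k hk d a ha => transferredOp_degree 𝒜 hdH hcontr hμ k hk d a ha) hm hne
  rw [opLetter]
  simp only
  rwa [show susDeg m + -1 - 1 = susDeg m + -2 by ring]

include hcontr hμ hβ in
theorem opLetter_branchWordOp_mem {m : List (Letter H)} (hm : ∀ x ∈ m, x.val ∈ ℋ x.dg)
    (hne : m ≠ []) : (opLetter (branchWordOp 𝒜 μ α h i β) 0 m).val ∈
      𝒜 (opLetter (branchWordOp 𝒜 μ α h i β) 0 m).dg := by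
  have h1 : branchWordOp 𝒜 μ α h i β m ∈ 𝒜 (susDeg m + -1) :=
    wordOp_mem (ℳ := 𝒜) (hβ ▸ hcontr.degree_transferred 𝒜 hμ)
      (fun k hk d a ha => branch_degree 𝒜 hμ.degree_α hμ.degree_μ hcontr.degree_h k hk d _
        fun j => by simpa using hcontr.degree_i _ _ (ha j)) hm hne
  rw [opLetter]
  simp only
  rwa [show susDeg m + 0 - 1 = susDeg m + -1 by ring]

theorem wordDer_add_apply {X M : Type*} [AddCommGroup M] (b : List X → X) (sg : List X → ℤˣ)
    (f g : List X → M) (w : List X) :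
    wordDer b sg (fun u => f u + g u) w = wordDer b sg f w + wordDer b sg g w :=
  congrFun (wordDer_add b sg f g) w

theorem wordDer_branchWordOp {w : List (Letter H)} (hne : w ≠ []) :
    wordDer (opLetter (transferredWordOp 𝒜 μ α h p i dH β) (-1)) wordSign
        (branchWordOp 𝒜 μ α h i β) w =
      i (transferredWordOp 𝒜 μ α h p i dH β w) -
        h (wordDer (opLetter (transferredWordOp 𝒜 μ α h p i dH β) (-1)) wordSign
          (treeWordOp 𝒜 μ α h i β) w) := by
  rw [wordDer_congr (g := fun u => onLetter (fun x => i x.val) u +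
    (-h).toAddMonoidHom (treeWordOp 𝒜 μ α h i β u)), wordDer_add_apply, ← map_wordDer,
    wordDer_onLetter _ wordSign_nil _ hne, sub_eq_add_neg]
  · rfl
  · intro u m v _ _
    rw [branchWordOp_eq 𝒜 (by simp), sub_eq_add_neg]
    rfl

theorem wordDer_transferredWordOp {w : List (Letter H)} (hne : w ≠ []) :
    wordDer (opLetter (transferredWordOp 𝒜 μ α h p i dH β) (-1)) wordSign
        (transferredWordOp 𝒜 μ α h p i dH β) w =
      dH (transferredWordOp 𝒜 μ α h p i dH β w) +
        p (wordDer (opLetter (transferredWordOp 𝒜 μ α h p i dH β) (-1)) wordSign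
          (treeWordOp 𝒜 μ α h i β) w) := by
  rw [wordDer_congr (g := fun u => onLetter (fun x => dH x.val) u +
    p.toAddMonoidHom (treeWordOp 𝒜 μ α h i β u)), wordDer_add_apply, ← map_wordDer,
    wordDer_onLetter _ wordSign_nil _ hne]
  · rfl
  · intro u m v _ _
    rw [transferredWordOp_eq 𝒜 (by simp)]
    rfl

include hcontr in
-- Insert `ψ = i - h T` and `b_H = d_H + p T`: the single-letter terms cancel because `i` is a chain
-- map, and the homotopy formula turns `(1 - i p - d_A h) T` into `h d_A T`.
theorem branchWordOp_defect {w : List (Letter H)} (hne : w ≠ []) :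
    treeWordOp 𝒜 μ α h i β w + dA (branchWordOp 𝒜 μ α h i β w) -
      wordDer (opLetter (transferredWordOp 𝒜 μ α h p i dH β) (-1)) wordSign
        (branchWordOp 𝒜 μ α h i β) w =
      h (dA (treeWordOp 𝒜 μ α h i β w) +
        wordDer (opLetter (transferredWordOp 𝒜 μ α h p i dH β) (-1)) wordSign
          (treeWordOp 𝒜 μ α h i β) w) := by
  have h1 : dA (onLetter (fun x : Letter H => i x.val) w) =
      i (onLetter (fun x : Letter H => dH x.val) w) := by
    rcases w with _ | ⟨x, _ | ⟨y, w⟩⟩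
    · exact absurd rfl hne
    · exact (hcontr.chain_i _).symm
    · simp [onLetter]
  rw [wordDer_branchWordOp 𝒜 hne, branchWordOp_eq 𝒜 hne, transferredWordOp_eq 𝒜 hne, map_sub, h1,
    map_add, map_add]
  have h2 := hcontr.homotopy (treeWordOp 𝒜 μ α h i β w)
  rw [← sub_eq_zero] at h2 ⊢
  rw [← h2]
  abel

include hdA hdH hcontr hμ hμ_one hα hβ in
-- By the defect formula, the induction hypothesis says that `F` intertwines the coderivations on
-- shorter words. Expanding `b_A F = T + d_A ψ` in the resulting formula, the terms `d_A ψ D_H`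
-- cancel and `d_A²` vanishes.
theorem treeWordOp_identity {w : List (Letter H)} (hw : ∀ x ∈ w, x.val ∈ ℋ x.dg) (hne : w ≠ []) :
    dA (treeWordOp 𝒜 μ α h i β w) +
      wordDer (opLetter (transferredWordOp 𝒜 μ α h p i dH β) (-1)) wordSign
        (treeWordOp 𝒜 μ α h i β) w = 0 := by
  induction hn : w.length using Nat.strong_induction_on generalizing w with
  | _ n ih =>
    have h1 := wordDer_wordLift_comorphism μ α (ψ := branchWordOp 𝒜 μ α h i β)
      (bH := transferredWordOp 𝒜 μ α h p i dH β) (Q := fun x => x.val ∈ ℋ x.dg)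
      (P := fun a => a.val ∈ 𝒜 a.dg)
      (fun u hu hQ => opLetter_branchWordOp_mem 𝒜 hcontr hμ hβ hQ hu)
      (wordDer_wordOp_eq_zero 𝒜 hμ) hw hne fun m hm hlt hQ => by
        rw [wordLift_comorphism_branchWordOp 𝒜 hcontr hμ hμ_one hα hβ hQ hm, ← sub_eq_zero,
          branchWordOp_defect 𝒜 hcontr hm, ih m.length (hn ▸ hlt) hQ hm rfl, map_zero]
    rw [wordDer_congr (g := fun u => treeWordOp 𝒜 μ α h i β u +
      dA.toAddMonoidHom (branchWordOp 𝒜 μ α h i β u)), wordDer_add_apply, ← map_wordDer,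
      wordLift_comorphism_branchWordOp 𝒜 hcontr hμ hμ_one hα hβ hw hne, hμ_one, map_sub,
      map_add, hdA.sq_zero, add_zero] at h1
    · change _ + dA _ = _ at h1
      rw [sub_eq_add_neg, add_comm, add_right_inj] at h1
      rw [h1, add_neg_cancel]
    · intro u m v huv hm
      refine wordLift_comorphism_branchWordOp 𝒜 hcontr hμ hμ_one hα hβ ?_ (by simp)
      intro x hx
      rw [← huv] at hw
      rcases List.mem_append.1 hx with hx | hx
      · exact hw x (by simp [hx])
      · rcases List.mem_cons.1 hx with rfl | hx
        · exact opLetter_transferredWordOp_mem 𝒜 hdH hcontr hμ hβ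
            (fun x hx => hw x (by simp [hx])) hm
        · exact hw x (by simp [hx])

include hdA hdH hcontr hμ hμ_one hα hβ in
-- Here `b_H D_H = d_H b_H + p T D_H`, and `d_H² = 0` with `d_H p = p d_A` turns this into `p (d_A T
-- + T D_H)`.
theorem transferredWordOp_identity {w : List (Letter H)} (hw : ∀ x ∈ w, x.val ∈ ℋ x.dg)
    (hne : w ≠ []) :
    wordDer (opLetter (transferredWordOp 𝒜 μ α h p i dH β) (-1)) wordSign
        (transferredWordOp 𝒜 μ α h p i dH β) w = 0 := by
  have h1 := congrArg p (treeWordOp_identity 𝒜 hdA hdH hcontr hμ hμ_one hα hβ hw hne)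
  rw [map_add, map_zero, hcontr.chain_p] at h1
  have h2 : dH (onLetter (fun x : Letter H => dH x.val) w) = 0 := by
    rcases w with _ | ⟨x, _ | ⟨y, w⟩⟩
    · exact absurd rfl hne
    · exact hdH.sq_zero _
    · simp [onLetter]
  rw [wordDer_transferredWordOp 𝒜 hne, transferredWordOp_eq 𝒜 hne, map_add, h2, zero_add, h1]

end Transferred

end HomAInfinity

theorem mainTheorem3 {K : Type*} [Field K] {A H : Type*} [AddCommGroup A] [Module K A]
    [AddCommGroup H] [Module K H]
    (𝒜 : ℤ → Submodule K A) [DirectSum.Decomposition 𝒜]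
    (ℋ : ℤ → Submodule K H) [DirectSum.Decomposition ℋ]
    (dA : A →ₗ[K] A) (dH : H →ₗ[K] H)
    (hdA : HomAInfinity.IsChainComplex 𝒜 dA) (hdH : HomAInfinity.IsChainComplex ℋ dH)
    (p : A →ₗ[K] H) (i : H →ₗ[K] A) (h : A →ₗ[K] A)
    (hcontr : HomAInfinity.IsContraction 𝒜 ℋ dA dH p i h)
    (μ : ∀ k : ℕ, MultilinearMap K (fun _ : Fin k => A) A) (α : A →ₗ[K] A)
    (hμ : HomAInfinity.IsHAInfinity 𝒜 μ α)
    (hμ_one : ∀ a : A, μ 1 (fun _ => a) = dA a)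
    (hα : ∀ a : A, α (h a) = h (α a)) :
    HomAInfinity.IsHAInfinity ℋ (HomAInfinity.transferredOp 𝒜 μ α dH p i h) (p ∘ₗ α ∘ₗ i) ∧
      ∀ x : H, HomAInfinity.transferredOp 𝒜 μ α dH p i h 1 (fun _ => x) = dH x := by
  refine ⟨⟨HomAInfinity.transferredOp_degree 𝒜 hdH hcontr hμ, hcontr.degree_transferred 𝒜 hμ,
    HomAInfinity.transferredOp_comm 𝒜 hcontr hμ hμ_one hα, ?_⟩, fun x => rfl⟩
  intro n hn d a ha
  have h_len : (List.ofFn fun q : Fin n => (⟨a q, 0, d q⟩ : HomAInfinity.Letter H)).length = n :=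
    List.length_ofFn
  -- Letters of weight `0` make every scaling power trivial, so the bar identity involves the
  -- elements `a q` themselves.
  have h1 := HomAInfinity.transferredWordOp_identity 𝒜 hdA hdH hcontr hμ hμ_one hα rfl
    (w := List.ofFn fun q : Fin n => ⟨a q, 0, d q⟩)
    (by
      intro x hx
      obtain ⟨q, rfl⟩ := (List.mem_ofFn' _ _).1 hx
      exact ha q)
    (List.ne_nil_of_length_pos (by rw [h_len]; exact hn))
  have h_wt : HomAInfinity.wtSum
      (List.ofFn fun q : Fin n => (⟨a q, 0, d q⟩ : HomAInfinity.Letter H)) = 0 := by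
    simp [HomAInfinity.wtSum, List.sum_ofFn]
  rw [HomAInfinity.transferredWordOp, HomAInfinity.wordDer_wordOp (a := a) (d := d)
    (HomAInfinity.transferredOp_comm 𝒜 hcontr hμ hμ_one hα), h_len] at h1
  -- The bar identity differs from the required one only by a global sign, which is a unit.
  · exact (smul_eq_zero_iff_eq _).1 h1
  · intro q hq
    rw [h_wt]
    simp
  · intro q hq
    simp
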